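/- Let $\Lambda=\mathbb Z^3$, $\Lambda^\vee=\mathrm{Hom}(\Lambda,\mathbb Z)$, $V_{\mathbb C}=\mathbb C^3$; elements of $\Lambda^\vee$ are evaluated on $V_{\mathbb C}$ by linearity, and $\Lambda^\vee$ is oriented by the determinant. Let $\Lambda_{prim}$ be the set of primitive vectors of $\Lambda$. For $a\in\Lambda_{prim}$ let $H(a)=\{\alpha\in\mathbb Q^{3}=\Lambda^\vee\otimes\mathbb Q:\alpha(a)=0\}$; a basis $\alpha,\beta$ of $H(a)$ is oriented if $\det(\alpha,\beta,\delta)>0$ whenever $\delta(a)>0$. Let $U_a^+\subset V_{\mathbb C}$ be the set of $x$ such that $\mathrm{Im}(\alpha(x)\overline{\beta(x)})>0$ for some (equivalently, every) oriented basis $\alpha,\beta$ of $H(a)$. For linearly independent $a,b\in\Lambda_{prim}$ let $\gamma\in\Lambda^\vee$ be the primitive element with $\det(a,b,\cdot)=s\gamma$, $s\in\mathbb Z_{>0}$, and put $C_{+-}=\{\delta\in\Lambda^\vee:\delta(a)>0,\ \delta(b)\le 0\}$, $C_{-+}=\{\delta\in\Lambda^\vee:\delta(a)\le 0,\ \delta(b)>0\}$.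 For $w\in\mathbb C$, $x\in U_a^+\cap U_b^+$ set $$\Gamma_{a,b}(w,x)=\frac{\prod_{\delta\in C_{+-}/\mathbb Z\gamma}\bigl(1-e^{-2\pi i(\delta(x)-w)/\gamma(x)}\bigr)}{\prod_{\delta\in C_{-+}/\mathbb Z\gamma}\bigl(1-e^{2\pi i(\delta(x)-w)/\gamma(x)}\bigr)}.$$ A framing $f$ assigns to each $a\in\Lambda_{prim}$ an oriented basis $f(a)=(\alpha_1,\alpha_2,\alpha_3)$ of the $\mathbb Z$-module $\Lambda^\vee$ with $\alpha_1(a)=1$ and $\alpha_2,\alpha_3\in H(a)$. With $\theta_0(z,\tau)=\prod_{j\ge 0}(1-e^{2\pi i((j+1)\tau-z)})(1-e^{2\pi i(j\tau+z)})$ for $\mathrm{Im}\,\tau>0$, set for $\mu\in\Lambda^\vee$ $$\Delta_a(\mu;w,x)=\prod_{j=0}^{\mu(a)-1}\theta_0\Bigl(\frac{w+j\alpha_1(x)}{\alpha_3(x)},\frac{\alpha_2(x)}{\alpha_3(x)}\Bigr),$$ which for $\mu(a)<0$ means $\prod_{j=\mu(a)}^{-1}\theta_0(\cdots)^{-1}$.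 **Proposition.** Let $a,b\in\Lambda_{prim}$ be linearly independent, fix a framing, and let $\mu\in\Lambda^\vee$. Then there is a polynomial $P_{a,b}(\mu;x,w)\in\mathbb Q(x)[w]$ (depending on the framing), of degree at most $2$ in $w$ and homogeneous of degree $0$ in $(x,w)$, with coefficients regular on $U_a^+\cap U_b^+$, such that for $x\in U_a^+\cap U_b^+$ $$\frac{\Gamma_{a,b}(w+\mu(x),x)}{\Gamma_{a,b}(w,x)}=e^{\pi i P_{a,b}(\mu;x,w)}\,\frac{\Delta_a(\mu;w,x)}{\Delta_b(\mu;w,x)}$$ as meromorphic functions: for each such $x$, the set of $w$ at which none of the products defining $\Gamma_{a,b}(w,x)$, $\Gamma_{a,b}(w+\mu(x),x)$, $\Delta_a(\mu;w,x)$, $\Delta_b(\mu;w,x)$ vanishes is the complement of a closed discrete subset of $\mathbb C$, and the identity holds at every $w$ in it. -/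

import Mathlib

noncomputable section

namespace GammaWedge

open Complex Polynomial

/-- The lattice `Λ = ℤ³`. -/
abbrev Lattice3 : Type := Fin 3 → ℤ

/-- The dual lattice `Λ^∨ = Hom(Λ, ℤ)`, identified with `ℤ³` through the dual basis. -/
abbrev DualLattice3 : Type := Fin 3 → ℤ

/-- The pairing `δ(a) ∈ ℤ` of `δ ∈ Λ^∨` with `a ∈ Λ`. -/
def pair (δ : DualLattice3) (a : Lattice3) : ℤ := ∑ i, δ i * a i

/-- The value `δ(x) ∈ ℂ` of `δ ∈ Λ^∨` at `x ∈ V_ℂ = ℂ³`. -/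
def ev (δ : DualLattice3) (x : Fin 3 → ℂ) : ℂ := ∑ i, (δ i : ℂ) * x i

/-- `v` is primitive if `v ∈ k M` with `k ∈ ℤ` implies `k = ±1` (so `0` is not primitive). -/
def IsPrimitive {M : Type*} [AddCommGroup M] (v : M) : Prop :=
  ∀ k : ℤ, (∃ u : M, v = k • u) → k = 1 ∨ k = -1

/-! ### Wedges -/

/-- The linear form `det(a, b, ·) ∈ Λ^∨`. -/
def detForm (a b : Lattice3) : DualLattice3 := fun i => Matrix.det (Matrix.of ![a, b, Pi.single i 1])

/-- The modulus of the wedge `(a, b)`: the content of the form `det(a, b, ·)`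
(zero if `a`, `b` are linearly dependent). -/
def modulus (a b : Lattice3) : ℕ := Finset.univ.gcd fun i => (detForm a b i).natAbs

/-- The direction vector `γ` of the wedge `(a, b)`: the primitive element of `Λ^∨` such that
`det(a, b, ·) = s γ` with a positive integer `s`; see `directionVector_spec` and
`directionVector_unique`. -/
def directionVector (a b : Lattice3) : DualLattice3 := fun i => detForm a b i / (modulus a b : ℤ)

/-- `Λ^∨_+(a)`. -/
def posHalf (a : Lattice3) : Set DualLattice3 := {δ | 0 < pair δ a}

/-- `Λ^∨_-(a)`. -/
def negHalf (a : Lattice3) : Set DualLattice3 := {δ | pair δ a ≤ 0}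

lemma ev_add (δ ε : DualLattice3) (x : Fin 3 → ℂ) : ev (δ + ε) x = ev δ x + ev ε x := by
  simp [ev, add_mul, Finset.sum_add_distrib]

lemma ev_zsmul (n : ℤ) (δ : DualLattice3) (x : Fin 3 → ℂ) : ev (n • δ) x = n * ev δ x := by
  simp [ev, Finset.mul_sum, mul_assoc]

lemma exp_shift (s n : ℤ) (z g : ℂ) :
    exp (s * (2 * Real.pi * I * ((z + n * g) / g))) = exp (s * (2 * Real.pi * I * (z / g))) := by
  by_cases hg : g = 0
  · simp [hg]
  · rw [Complex.exp_eq_exp_iff_exists_int]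
    refine ⟨s * n, ?_⟩
    push_cast
    field_simp

/-- The factor `1 - e^{2πi s (δ(x) - w)/γ(x)}` (with `s = ±1`), which depends only on the class of
`δ` in `Λ^∨ / ℤγ`. -/
def wedgeFactor (s : ℤ) (γ : DualLattice3) (w : ℂ) (x : Fin 3 → ℂ) :
    DualLattice3 ⧸ AddSubgroup.zmultiples γ → ℂ :=
  Quotient.lift
    (fun δ : DualLattice3 => 1 - exp (s * (2 * Real.pi * I * ((ev δ x - w) / ev γ x)))) (by
      intro δ ε h
      have h' : -δ + ε ∈ AddSubgroup.zmultiples γ := QuotientAddGroup.leftRel_apply.mp h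
      obtain ⟨n, hn⟩ := AddSubgroup.mem_zmultiples_iff.mp h'
      have hε : ε = δ + n • γ := by rw [hn]; abel
      have hz : ev ε x - w = (ev δ x - w) + n * ev γ x := by
        rw [hε, ev_add, ev_zsmul]; ring
      show 1 - _ = 1 - _
      rw [hz, exp_shift])

/-- The gamma function `Γ_{a,b}(w, x)` of the wedge `(a, b)`, the quotient of the products of
`1 - e^{-2πi(δ(x) - w)/γ(x)}` over `δ ∈ C_{+-}(a,b)/ℤγ` and of
`1 - e^{2πi(δ(x) - w)/γ(x)}` over `δ ∈ C_{-+}(a,b)/ℤγ`. -/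
def gammaFun (a b : Lattice3) (w : ℂ) (x : Fin 3 → ℂ) : ℂ :=
  (∏' q : ((fun δ : DualLattice3 => (δ : DualLattice3 ⧸ AddSubgroup.zmultiples (directionVector a b))) ''
      (posHalf a ∩ negHalf b)), wedgeFactor (-1) (directionVector a b) w x q) /
  (∏' q : ((fun δ : DualLattice3 => (δ : DualLattice3 ⧸ AddSubgroup.zmultiples (directionVector a b))) ''
      (negHalf a ∩ posHalf b)), wedgeFactor 1 (directionVector a b) w x q)

/-- `(α, β)` is an oriented basis of the plane `H(a) = {α ∈ V^* | α(a) = 0}`, `V^* = ℚ³`. -/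
def IsOrientedBasis (a : Lattice3) (α β : Fin 3 → ℚ) : Prop :=
  (∑ i, α i * (a i : ℚ) = 0) ∧ (∑ i, β i * (a i : ℚ) = 0) ∧ LinearIndependent ℚ ![α, β] ∧
    ∀ δ : Fin 3 → ℚ, 0 < ∑ i, δ i * (a i : ℚ) → 0 < Matrix.det (Matrix.of ![α, β, δ])

/-- The open set `U_a^+ ⊆ V_ℂ`. -/
def domain (a : Lattice3) : Set (Fin 3 → ℂ) :=
  {x | ∃ α β : Fin 3 → ℚ, IsOrientedBasis a α β ∧
    0 < ((∑ i, (α i : ℂ) * x i) * (starRingEnd ℂ) (∑ i, (β i : ℂ) * x i)).im}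

/-! ### Theta functions and framings -/

/-- The theta function `θ_0(z, τ)`, `Im τ > 0`. -/
def theta0 (z τ : ℂ) : ℂ :=
  ∏' j : ℕ, (1 - exp (2 * Real.pi * I * ((j + 1) * τ - z))) *
    (1 - exp (2 * Real.pi * I * (j * τ + z)))

/-- A framing of `Λ_prim`: an oriented basis `(α₁, α₂, α₃)` of `Λ^∨` for each primitive `a`, such
that `α₁(a) = 1` and `α₂, α₃ ∈ H(a)`. (The indices in the code are `0, 1, 2`.) -/
structure Framing where
  basis : {a : Lattice3 // IsPrimitive a} → Module.Basis (Fin 3) ℤ DualLattice3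
  oriented : ∀ a, 0 < Matrix.det (Matrix.of fun i => basis a i)
  pair_one : ∀ a, pair (basis a 0) a = 1
  pair_two : ∀ a, pair (basis a 1) a = 0
  pair_three : ∀ a, pair (basis a 2) a = 0

/-- `Δ_a(μ; w, x)`: the product over `0 ≤ j < μ(a)` of
`θ_0((w + j α₁(x))/α₃(x), α₂(x)/α₃(x))`, where `(α₁, α₂, α₃)` is the basis assigned to `a`;
if `μ(a) < 0`, it is the inverse of the product over `μ(a) ≤ j < 0`. -/
def Delta (f : Framing) (a : {a : Lattice3 // IsPrimitive a}) (μ : DualLattice3) (w : ℂ)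
    (x : Fin 3 → ℂ) : ℂ :=
  (∏ j ∈ Finset.Ico 0 (pair μ a), theta0
    ((w + (j : ℂ) * ev (f.basis a 0) x) / ev (f.basis a 2) x)
    (ev (f.basis a 1) x / ev (f.basis a 2) x)) /
  (∏ j ∈ Finset.Ico (pair μ a) 0, theta0
    ((w + (j : ℂ) * ev (f.basis a 0) x) / ev (f.basis a 2) x)
    (ev (f.basis a 1) x / ev (f.basis a 2) x))

/-! ### Polynomials in `ℚ(x)[w]` -/

/-- The field `ℚ(x) = ℚ(x₁, x₂, x₃)`. -/
abbrev RatField : Type := FractionRing (MvPolynomial (Fin 3) ℚ)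

/-- `r ∈ ℚ(x)` is homogeneous of degree `k ∈ ℤ`. -/
def IsHomogeneousRat (r : RatField) (k : ℤ) : Prop :=
  ∃ (p q : MvPolynomial (Fin 3) ℚ) (m n : ℕ), p.IsHomogeneous m ∧ q.IsHomogeneous n ∧ q ≠ 0 ∧
    r = algebraMap _ RatField p / algebraMap _ RatField q ∧ (m : ℤ) - n = k

/-- `r ∈ ℚ(x)` is defined at `x ∈ ℂ³`: its reduced denominator does not vanish there. -/
def RegularAt (r : RatField) (x : Fin 3 → ℂ) : Prop :=
  MvPolynomial.aeval x
    (IsFractionRing.den (MvPolynomial (Fin 3) ℚ) r : MvPolynomial (Fin 3) ℚ) ≠ 0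

/-- The value of `r ∈ ℚ(x)` at `x ∈ ℂ³`, from its reduced fraction. -/
def evalRat (r : RatField) (x : Fin 3 → ℂ) : ℂ :=
  MvPolynomial.aeval x (IsFractionRing.num (MvPolynomial (Fin 3) ℚ) r) /
    MvPolynomial.aeval x
      (IsFractionRing.den (MvPolynomial (Fin 3) ℚ) r : MvPolynomial (Fin 3) ℚ)

/-- `P ∈ ℚ(x)[w]` is homogeneous of degree `0` in `(x, w)`: the coefficient of `w^i` is homogeneous
of degree `-i`. -/
def IsHomogeneousZero (P : RatField[X]) : Prop :=
  ∀ i : ℕ, IsHomogeneousRat (P.coeff i) (-(i : ℤ))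

/-- The value of `P ∈ ℚ(x)[w]` at `(x, w)`. -/
def evalPoly (P : RatField[X]) (x : Fin 3 → ℂ) (w : ℂ) : ℂ :=
  P.sum fun i c => evalRat c x * w ^ i

/-! ### The direction vector has the defining properties -/

lemma detForm_pair (a b c : Lattice3) : pair (detForm a b) c = Matrix.det (Matrix.of ![a, b, c]) := by
  simp [pair, detForm, Fin.sum_univ_three, Matrix.det_fin_three]
  ring

lemma detForm_ne_zero {a b : Lattice3} (h : LinearIndependent ℤ ![a, b]) : detForm a b ≠ 0 := by
  intro h0
  have e0 := congrFun h0 0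
  have e1 := congrFun h0 1
  have e2 := congrFun h0 2
  simp [detForm, Matrix.det_fin_three] at e0 e1 e2
  rw [LinearIndependent.pair_iff] at h
  have key : ∀ i, a i = 0 ∧ b i = 0 := by
    intro i
    have hh := h (b i) (-(a i)) (by
      ext j
      fin_cases i <;> fin_cases j <;> simp <;> linarith)
    exact ⟨by simpa using hh.2, hh.1⟩
  have h1 := h 1 0 (by ext j; simp [(key j).1])
  exact one_ne_zero h1.1

lemma modulus_pos {a b : Lattice3} (h : LinearIndependent ℤ ![a, b]) : 0 < modulus a b := by
  rcases Nat.eq_zero_or_pos (modulus a b) with h0 | h0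
  · exfalso
    apply detForm_ne_zero h
    ext i
    have := Finset.gcd_eq_zero_iff.mp h0 i (Finset.mem_univ i)
    simpa using this
  · exact h0

lemma modulus_smul (a b : Lattice3) : detForm a b = (modulus a b : ℤ) • directionVector a b := by
  ext i
  have hd : (modulus a b : ℤ) ∣ detForm a b i := by
    rw [← Int.natAbs_dvd_natAbs]
    exact Finset.gcd_dvd (f := fun i => (detForm a b i).natAbs) (Finset.mem_univ i)
  simp [directionVector, Int.mul_ediv_cancel' hd]

/-- `γ` is primitive and `det(a, b, c) = s γ(c)` with `s > 0`. -/
theorem directionVector_spec {a b : Lattice3} (h : LinearIndependent ℤ ![a, b]) :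
    IsPrimitive (directionVector a b) ∧ 0 < modulus a b ∧
      ∀ c : Lattice3, Matrix.det (Matrix.of ![a, b, c]) = modulus a b * pair (directionVector a b) c := by
  refine ⟨?_, modulus_pos h, ?_⟩
  · rintro k ⟨u, hu⟩
    have hdv : modulus a b * k.natAbs ∣ modulus a b := by
      refine Finset.dvd_gcd fun i _ => ?_
      have e := congrFun (modulus_smul a b) i
      rw [hu] at e
      simp only [Pi.smul_apply, smul_eq_mul] at e
      rw [e, Int.natAbs_mul, Int.natAbs_mul, Int.natAbs_natCast]
      exact ⟨(u i).natAbs, by ring⟩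
    have h1 : k.natAbs ∣ 1 := by
      have := modulus_pos h
      exact Nat.dvd_of_mul_dvd_mul_left this (by simpa using hdv)
    have := Nat.dvd_one.mp h1
    omega
  · intro c
    rw [← detForm_pair]
    conv_lhs => rw [modulus_smul]
    simp [pair, Finset.mul_sum, mul_assoc]

theorem directionVector_unique {a b : Lattice3} (γ : DualLattice3)
    (s : ℕ) (hγ : IsPrimitive γ) (hs : 0 < s)
    (hd : ∀ c : Lattice3, Matrix.det (Matrix.of ![a, b, c]) = s * pair γ c) : γ = directionVector a b := by
  have hform : detForm a b = (s : ℤ) • γ := by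
    ext i
    show Matrix.det (Matrix.of ![a, b, Pi.single i 1]) = _
    rw [hd]
    simp [pair, Pi.single_apply]
  have hsm : s ∣ modulus a b := by
    refine Finset.dvd_gcd fun i _ => ?_
    rw [hform]
    simp [Int.natAbs_mul]
  obtain ⟨t, ht⟩ := hsm
  have hs' : (s : ℤ) ≠ 0 := by exact_mod_cast hs.ne'
  have hγt : γ = (t : ℤ) • directionVector a b := by
    have e := modulus_smul a b
    rw [hform, ht] at e
    ext i
    have ei := congrFun e i
    simp only [Pi.smul_apply, smul_eq_mul, Nat.cast_mul, mul_assoc] at ei ⊢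
    exact mul_left_cancel₀ hs' ei
  have : (t : ℤ) = 1 ∨ (t : ℤ) = -1 := hγ t ⟨_, hγt⟩
  have ht1 : (t : ℤ) = 1 := by omega
  rw [hγt, ht1, one_smul]

end GammaWedge

end

open GammaWedge

/-!
Translating `w` by `μ(x)` moves the boundaries of the two cones in `Γ_{a,b}` by `μ(a)` and `μ(b)`
steps. Moving one boundary by one step multiplies `Γ_{a,b}` by a product over a single row of forms
`δ` with `δ(a)` fixed, and this product is a theta function `θ₀` attached to an oriented basis of
`H(a) ∩ Λ^∨` that contains `γ`, whereas `Δ_a` uses the basis from the framing. By the behaviour of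
`θ₀` under `SL₂(ℤ)` and under translation of `w` by the lattice `H(a) ∩ Λ^∨`, the two differ by the
exponential of a polynomial of degree at most `2` in `w`. The modular transformation of `θ₀` is
read off from that of Jacobi's theta function and of the Dedekind eta function through the triple
product identity.
-/

noncomputable section

namespace GammaWedge

open Complex Polynomial
open scoped Matrix

/-! ### Exponents with rational coefficients -/

lemma exists_eq_num_mul_and_eq_den_mul {A K : Type*} [CommRing A] [IsDomain A]
    [UniqueFactorizationMonoid A] [Field K] [Algebra A K] [IsFractionRing A K] (p : A) {q : A}
    (hq : q ≠ 0) :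
    ∃ c, p = IsFractionRing.num A (algebraMap A K p / algebraMap A K q) * c ∧
      q = IsFractionRing.den A (algebraMap A K p / algebraMap A K q) * c := by
  set r := algebraMap A K p / algebraMap A K q with hr
  have hd : (IsFractionRing.den A r : A) ≠ 0 := nonZeroDivisors.ne_zero (Subtype.prop _)
  have hcross : IsFractionRing.num A r * q = IsFractionRing.den A r * p := by
    have h := (IsFractionRing.mk'_num_den' A r).trans hr
    rw [div_eq_div_iff (by simp) (by simpa using hq)] at h
    apply IsFractionRing.injective A K
    rw [map_mul, map_mul, h, mul_comm]
  obtain ⟨c, hc⟩ : (IsFractionRing.den A r : A) ∣ q :=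
    (IsFractionRing.num_den_reduced A r).symm.dvd_of_dvd_mul_left ⟨p, hcross⟩
  refine ⟨c, mul_left_cancel₀ hd ?_, hc⟩
  rw [← hcross, hc, mul_left_comm]

section RationalFunctions

variable {U : Set (Fin 3 → ℂ)} {k l : ℤ} {r s : RatField} {u v : (Fin 3 → ℂ) → ℂ}

lemma regularAt_and_evalRat_eq_iff {x : Fin 3 → ℂ} {z : ℂ} :
    RegularAt r x ∧ evalRat r x = z ↔ ∃ p q : MvPolynomial (Fin 3) ℚ,
      r = algebraMap _ RatField p / algebraMap _ RatField q ∧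
        MvPolynomial.aeval x q ≠ 0 ∧ MvPolynomial.aeval x p / MvPolynomial.aeval x q = z := by
  refine ⟨fun ⟨hr, hz⟩ => ⟨_, _, (IsFractionRing.mk'_num_den' _ r).symm, hr, hz⟩, ?_⟩
  rintro ⟨p, q, rfl, hq, rfl⟩
  have hq₀ : q ≠ 0 := by rintro rfl; simp at hq
  obtain ⟨c, hpc, hqc⟩ := exists_eq_num_mul_and_eq_den_mul (K := RatField) p hq₀
  replace hpc := congrArg (MvPolynomial.aeval x) hpc
  replace hqc := congrArg (MvPolynomial.aeval x) hqc
  rw [map_mul] at hpc hqc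
  rw [hqc] at hq
  exact ⟨left_ne_zero_of_mul hq, by
    rw [evalRat, hpc, hqc, mul_div_mul_right _ _ (right_ne_zero_of_mul hq)]⟩

lemma algebraMap_ratField_ne_zero {q : MvPolynomial (Fin 3) ℚ} (hq : q ≠ 0) :
    algebraMap _ RatField q ≠ 0 := by
  simpa using hq

lemma isHomogeneousRat_zero (k : ℤ) : IsHomogeneousRat 0 k := by
  refine ⟨0, MvPolynomial.X 0 ^ (-k).toNat, k.toNat, (-k).toNat,
    MvPolynomial.isHomogeneous_zero _ _ _, ?_, pow_ne_zero _ (MvPolynomial.X_ne_zero _), by simp,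
    by omega⟩
  simpa using (MvPolynomial.isHomogeneous_X ℚ (0 : Fin 3)).pow (-k).toNat

lemma isHomogeneousRat_C (c : ℚ) :
    IsHomogeneousRat (algebraMap (MvPolynomial (Fin 3) ℚ) RatField (MvPolynomial.C c)) 0 :=
  ⟨MvPolynomial.C c, 1, 0, 0, MvPolynomial.isHomogeneous_C _ _, MvPolynomial.isHomogeneous_one _ _,
    one_ne_zero, by simp, by simp⟩

lemma IsHomogeneousRat.add (hr : IsHomogeneousRat r k) (hs : IsHomogeneousRat s k) :
    IsHomogeneousRat (r + s) k := by
  obtain ⟨p, q, m, n, hp, hq, hq₀, rfl, hk⟩ := hr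
  obtain ⟨p', q', m', n', hp', hq', hq₀', rfl, hk'⟩ := hs
  have hdeg : n + m' = m + n' := by omega
  refine ⟨p * q' + q * p', q * q', m + n', n + n', (hp.mul hq').add (hdeg ▸ hq.mul hp'),
    hq.mul hq', mul_ne_zero hq₀ hq₀', ?_, by push_cast; omega⟩
  rw [div_add_div _ _ (algebraMap_ratField_ne_zero hq₀) (algebraMap_ratField_ne_zero hq₀')]
  simp only [map_mul, map_add]

lemma IsHomogeneousRat.mul (hr : IsHomogeneousRat r k) (hs : IsHomogeneousRat s l) :
    IsHomogeneousRat (r * s) (k + l) := by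
  obtain ⟨p, q, m, n, hp, hq, hq₀, rfl, rfl⟩ := hr
  obtain ⟨p', q', m', n', hp', hq', hq₀', rfl, rfl⟩ := hs
  refine ⟨p * p', q * q', m + m', n + n', hp.mul hp', hq.mul hq', mul_ne_zero hq₀ hq₀', ?_,
    by push_cast; ring⟩
  rw [div_mul_div_comm, map_mul, map_mul]

/-- `v` is given on `U` by the rational function `r`, which is regular there. -/
def Represents (U : Set (Fin 3 → ℂ)) (r : RatField) (v : (Fin 3 → ℂ) → ℂ) : Prop :=
  ∀ x ∈ U, RegularAt r x ∧ evalRat r x = v x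

lemma Represents.of_div {p q : MvPolynomial (Fin 3) ℚ} (hq : ∀ x ∈ U, MvPolynomial.aeval x q ≠ 0) :
    Represents U (algebraMap _ RatField p / algebraMap _ RatField q)
      fun x => MvPolynomial.aeval x p / MvPolynomial.aeval x q :=
  fun x hx => regularAt_and_evalRat_eq_iff.mpr ⟨p, q, rfl, hq x hx, rfl⟩

lemma Represents.of_polynomial (p : MvPolynomial (Fin 3) ℚ) :
    Represents U (algebraMap _ RatField p) (MvPolynomial.aeval · p) := by
  simpa using Represents.of_div (U := U) (p := p) (q := 1) (by simp)

lemma represents_zero : Represents U 0 0 := by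
  simpa [Pi.zero_def] using Represents.of_polynomial (U := U) 0

lemma Represents.add (hu : Represents U r u) (hv : Represents U s v) :
    Represents U (r + s) (u + v) := by
  intro x hx
  obtain ⟨p, q, rfl, hq, hpq⟩ := regularAt_and_evalRat_eq_iff.mp (hu x hx)
  obtain ⟨p', q', rfl, hq', hpq'⟩ := regularAt_and_evalRat_eq_iff.mp (hv x hx)
  have hq₀ : q ≠ 0 := by rintro rfl; simp at hq
  have hq₀' : q' ≠ 0 := by rintro rfl; simp at hq'
  refine regularAt_and_evalRat_eq_iff.mpr ⟨p * q' + q * p', q * q', ?_, ?_, ?_⟩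
  · rw [div_add_div _ _ (algebraMap_ratField_ne_zero hq₀) (algebraMap_ratField_ne_zero hq₀')]
    simp only [map_mul, map_add]
  · rw [map_mul]
    exact mul_ne_zero hq hq'
  · simp only [map_mul, map_add, Pi.add_apply, ← hpq, ← hpq', div_add_div _ _ hq hq']

lemma Represents.mul (hu : Represents U r u) (hv : Represents U s v) :
    Represents U (r * s) (u * v) := by
  intro x hx
  obtain ⟨p, q, rfl, hq, hpq⟩ := regularAt_and_evalRat_eq_iff.mp (hu x hx)
  obtain ⟨p', q', rfl, hq', hpq'⟩ := regularAt_and_evalRat_eq_iff.mp (hv x hx)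
  refine regularAt_and_evalRat_eq_iff.mpr ⟨p * p', q * q', ?_, ?_, ?_⟩
  · simp only [map_mul, div_mul_div_comm]
  · rw [map_mul]
    exact mul_ne_zero hq hq'
  · simp only [map_mul, Pi.mul_apply, ← hpq, ← hpq', div_mul_div_comm]

/-- The functions given on `U` by a rational function over `ℚ` that is homogeneous of degree `k`
and regular on `U`. Their values off `U` are arbitrary. -/
def ratFun (U : Set (Fin 3 → ℂ)) (k : ℤ) : Submodule ℚ ((Fin 3 → ℂ) → ℂ) where
  carrier := {v | ∃ r : RatField, IsHomogeneousRat r k ∧ Represents U r v}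
  zero_mem' := ⟨0, isHomogeneousRat_zero k, represents_zero⟩
  add_mem' := fun ⟨r, hr, hu⟩ ⟨s, hs, hv⟩ => ⟨r + s, hr.add hs, hu.add hv⟩
  smul_mem' := by
    rintro c v ⟨r, hr, hv⟩
    refine ⟨algebraMap _ RatField (MvPolynomial.C c) * r,
      by simpa using (isHomogeneousRat_C c).mul hr, ?_⟩
    convert (Represents.of_polynomial (MvPolynomial.C c)).mul hv using 1
    ext x
    simp [Algebra.smul_def]

lemma mul_mem_ratFun (hu : u ∈ ratFun U k) (hv : v ∈ ratFun U l) : u * v ∈ ratFun U (k + l) := by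
  obtain ⟨r, hr, hu⟩ := hu
  obtain ⟨s, hs, hv⟩ := hv
  exact ⟨r * s, hr.mul hs, hu.mul hv⟩

lemma const_mem_ratFun (c : ℚ) : (fun _ => (c : ℂ)) ∈ ratFun U 0 :=
  ⟨_, isHomogeneousRat_C c, by simpa using Represents.of_polynomial (U := U) (MvPolynomial.C c)⟩

/-- The linear form `x ↦ δ(x)` as a polynomial. -/
def linearForm (δ : DualLattice3) : MvPolynomial (Fin 3) ℚ :=
  ∑ i, MvPolynomial.C (δ i : ℚ) * MvPolynomial.X i

lemma isHomogeneous_linearForm (δ : DualLattice3) : (linearForm δ).IsHomogeneous 1 :=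
  MvPolynomial.IsHomogeneous.sum _ _ _ fun i _ => by
    simpa using (MvPolynomial.isHomogeneous_C (Fin 3) (δ i : ℚ)).mul
      (MvPolynomial.isHomogeneous_X ℚ i)

lemma aeval_linearForm (δ : DualLattice3) (x : Fin 3 → ℂ) :
    MvPolynomial.aeval x (linearForm δ) = ev δ x := by
  simp [linearForm, ev]

lemma ev_mem_ratFun (δ : DualLattice3) : ev δ ∈ ratFun U 1 :=
  ⟨algebraMap _ RatField (linearForm δ), ⟨linearForm δ, 1, 1, 0, isHomogeneous_linearForm δ,
    MvPolynomial.isHomogeneous_one _ _, one_ne_zero, by simp, by simp⟩, by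
    simpa only [aeval_linearForm] using Represents.of_polynomial (linearForm δ)⟩

lemma linearForm_ne_zero {δ : DualLattice3} (hδ : δ ≠ 0) : linearForm δ ≠ 0 := by
  contrapose! hδ
  ext i
  have := congrArg (MvPolynomial.aeval (Pi.single i (1 : ℚ))) hδ
  simpa [linearForm, Pi.single_apply] using this

lemma inv_ev_mem_ratFun {δ : DualLattice3} (hδ : δ ≠ 0) (hU : ∀ x ∈ U, ev δ x ≠ 0) :
    (ev δ)⁻¹ ∈ ratFun U (-1) := by
  refine ⟨_, ⟨1, linearForm δ, 0, 1, MvPolynomial.isHomogeneous_one _ _, isHomogeneous_linearForm δ,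
    linearForm_ne_zero hδ, rfl, by simp⟩, ?_⟩
  convert Represents.of_div (p := 1) (q := linearForm δ) (by simpa only [aeval_linearForm] using hU)
  simp [aeval_linearForm]

end RationalFunctions

section Exponents

variable {U : Set (Fin 3 → ℂ)} {φ : (Fin 3 → ℂ) → ℂ → ℂ} {u : (Fin 3 → ℂ) → ℂ}

/-- The functions `φ(x, w)` given for `x ∈ U` by a polynomial of degree at most two in `w`,
homogeneous of degree `0` in `(x, w)`, whose coefficients are rational and regular on `U`: the
values of the polynomials `P` of the theorem. -/
def exponents (U : Set (Fin 3 → ℂ)) : Submodule ℚ ((Fin 3 → ℂ) → ℂ → ℂ) where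
  carrier := {φ | ∃ u₀ ∈ ratFun U 0, ∃ u₁ ∈ ratFun U (-1), ∃ u₂ ∈ ratFun U (-2),
    ∀ x ∈ U, ∀ w, φ x w = u₀ x + u₁ x * w + u₂ x * w ^ 2}
  zero_mem' := ⟨0, zero_mem _, 0, zero_mem _, 0, zero_mem _, by simp⟩
  add_mem' := by
    rintro φ ψ ⟨u₀, h₀, u₁, h₁, u₂, h₂, hφ⟩ ⟨v₀, k₀, v₁, k₁, v₂, k₂, hψ⟩
    refine ⟨_, add_mem h₀ k₀, _, add_mem h₁ k₁, _, add_mem h₂ k₂, fun x hx w => ?_⟩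
    simp only [Pi.add_apply, hφ x hx, hψ x hx]
    ring
  smul_mem' := by
    rintro c φ ⟨u₀, h₀, u₁, h₁, u₂, h₂, hφ⟩
    refine ⟨_, Submodule.smul_mem _ c h₀, _, Submodule.smul_mem _ c h₁, _,
      Submodule.smul_mem _ c h₂, fun x hx w => ?_⟩
    simp only [Pi.smul_apply, hφ x hx, Algebra.smul_def]
    ring

lemma ratFun_mem_exponents (hu : u ∈ ratFun U 0) : (fun x _ => u x) ∈ exponents U :=
  ⟨u, hu, 0, zero_mem _, 0, zero_mem _, by simp⟩

lemma ratFun_mul_mem_exponents (hu : u ∈ ratFun U (-1)) : (fun x w => u x * w) ∈ exponents U :=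
  ⟨0, zero_mem _, u, hu, 0, zero_mem _, by simp⟩

lemma ratFun_mul_sq_mem_exponents (hu : u ∈ ratFun U (-2)) :
    (fun x w => u x * w ^ 2) ∈ exponents U :=
  ⟨0, zero_mem _, 0, zero_mem _, u, hu, by simp⟩

lemma shift_mem_exponents (δ : DualLattice3) (hφ : φ ∈ exponents U) :
    (fun x w => φ x (w + ev δ x)) ∈ exponents U := by
  obtain ⟨u₀, h₀, u₁, h₁, u₂, h₂, h⟩ := hφ
  have hδ := ev_mem_ratFun (U := U) δ
  have h₁δ := mul_mem_ratFun h₁ hδ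
  have h₂δ := mul_mem_ratFun h₂ hδ
  refine ⟨_, add_mem (add_mem h₀ h₁δ) (mul_mem_ratFun h₂δ hδ), _,
    add_mem h₁ (add_mem h₂δ h₂δ), u₂, h₂, fun x hx w => ?_⟩
  simp only [h x hx, Pi.add_apply, Pi.mul_apply]
  ring

lemma evalPoly_quadratic (r₀ r₁ r₂ : RatField) (x : Fin 3 → ℂ) (w : ℂ) :
    evalPoly (C r₂ * X ^ 2 + C r₁ * X + C r₀) x w =
      evalRat r₀ x + evalRat r₁ x * w + evalRat r₂ x * w ^ 2 := by
  have hzero : evalRat 0 x = 0 := (represents_zero x (Set.mem_univ x)).2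
  rw [evalPoly, Polynomial.sum_over_range' _ (by simp [hzero]) 3
    (natDegree_quadratic_le.trans_lt (by norm_num))]
  simp [Finset.sum_range_succ, coeff_C, coeff_X]

lemma coeff_quadratic_mem {R : Type*} [Semiring R] {p : ℕ → R → Prop} (hzero : ∀ i, p i 0)
    {r₀ r₁ r₂ : R} (h₀ : p 0 r₀) (h₁ : p 1 r₁) (h₂ : p 2 r₂) (i : ℕ) :
    p i ((C r₂ * X ^ 2 + C r₁ * X + C r₀).coeff i) := by
  rcases i with _ | _ | _ | i
  · simpa using h₀
  · simpa [coeff_C] using h₁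
  · simpa using h₂
  · rw [coeff_eq_zero_of_natDegree_lt (natDegree_quadratic_le.trans_lt (by omega))]
    exact hzero _

lemma exists_polynomial_of_mem_exponents (hφ : φ ∈ exponents U) :
    ∃ P : RatField[X], P.degree ≤ 2 ∧ IsHomogeneousZero P ∧
      ∀ x ∈ U, (∀ i : ℕ, RegularAt (P.coeff i) x) ∧ ∀ w, evalPoly P x w = φ x w := by
  obtain ⟨u₀, ⟨r₀, hr₀, h₀⟩, u₁, ⟨r₁, hr₁, h₁⟩, u₂, ⟨r₂, hr₂, h₂⟩, hφ⟩ := hφ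
  refine ⟨C r₂ * X ^ 2 + C r₁ * X + C r₀, degree_quadratic_le,
    coeff_quadratic_mem (p := fun i r => IsHomogeneousRat r (-(i : ℤ)))
      (fun i => isHomogeneousRat_zero _) hr₀ hr₁ hr₂, fun x hx => ⟨?_, fun w => ?_⟩⟩
  · exact coeff_quadratic_mem (p := fun _ r => RegularAt r x) (fun _ => (represents_zero x hx).1)
      (h₀ x hx).1 (h₁ x hx).1 (h₂ x hx).1
  · rw [evalPoly_quadratic, (h₀ x hx).2, (h₁ x hx).2, (h₂ x hx).2, hφ x hx]

end Exponents

/-! ### The Jacobi triple product -/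

section GaussBinomial

open Finset.HasAntidiagonal (antidiagonal mem_antidiagonal)

variable {K : Type*} [Field K] {q : K}

/-- The `q`-Pochhammer symbol `(q; q)_n`. -/
def qPochhammer (q : K) (n : ℕ) : K := ∏ i ∈ Finset.range n, (1 - q ^ (i + 1))

lemma qPochhammer_succ (q : K) (n : ℕ) :
    qPochhammer q (n + 1) = qPochhammer q n * (1 - q ^ (n + 1)) :=
  Finset.prod_range_succ _ _

lemma prod_range_one_add_mul_pow (hq : ∀ n, qPochhammer q n ≠ 0) (x : K) (N : ℕ) :
    ∏ j ∈ Finset.range N, (1 + x * q ^ j) = qPochhammer q N *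
      ∑ p ∈ antidiagonal N,
        q ^ p.1.choose 2 * x ^ p.1 / (qPochhammer q p.1 * qPochhammer q p.2) := by
  have hfactor (m : ℕ) : 1 - q ^ (m + 1) ≠ 0 := by
    have h := hq (m + 1)
    rw [qPochhammer_succ] at h
    exact right_ne_zero_of_mul h
  induction N with
  | zero => simp [qPochhammer]
  | succ N ih =>
    rw [Finset.prod_range_succ, ih, qPochhammer_succ, mul_assoc, mul_assoc]
    congr 1
    have hpascal : ∀ p ∈ antidiagonal (N + 1),
        (1 - q ^ (N + 1)) * (q ^ p.1.choose 2 * x ^ p.1 / (qPochhammer q p.1 * qPochhammer q p.2)) =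
          (1 - q ^ p.2) * (q ^ p.1.choose 2 * x ^ p.1 / (qPochhammer q p.1 * qPochhammer q p.2)) +
          q ^ p.2 * (1 - q ^ p.1) *
            (q ^ p.1.choose 2 * x ^ p.1 / (qPochhammer q p.1 * qPochhammer q p.2)) := by
      intro p hp
      rw [← mem_antidiagonal.mp hp, pow_add]
      ring
    rw [Finset.mul_sum, Finset.sum_congr rfl hpascal, Finset.sum_add_distrib,
      Finset.Nat.sum_antidiagonal_succ', Finset.Nat.sum_antidiagonal_succ]
    simp only [pow_zero, sub_self, zero_mul, mul_zero, zero_add]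
    rw [mul_add, mul_one, Finset.sum_mul]
    congr 1
    · refine Finset.sum_congr rfl fun p _ => ?_
      rw [qPochhammer_succ]
      have := hfactor p.2
      field_simp [hq]
    · refine Finset.sum_congr rfl fun p hp => ?_
      rw [qPochhammer_succ, Nat.choose_succ_succ' p.1 1, Nat.choose_one_right,
        ← mem_antidiagonal.mp hp]
      have := hfactor p.1
      field_simp [hq]
      ring

/-- The function `1 / (q; q)_k` of `k ∈ ℤ`, which is zero for `k < 0`: with this convention the sum
in the `q`-binomial theorem runs over all integers. -/
def invQPochhammer (q : K) (k : ℤ) : K := if 0 ≤ k then (qPochhammer q k.toNat)⁻¹ else 0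

lemma invQPochhammer_natCast (q : K) (n : ℕ) : invQPochhammer q n = (qPochhammer q n)⁻¹ := by
  simp [invQPochhammer]

lemma invQPochhammer_of_neg (q : K) {k : ℤ} (hk : k < 0) : invQPochhammer q k = 0 :=
  if_neg hk.not_ge

/-- The `q`-binomial coefficient `(q; q)_{2n} / ((q; q)_{n+m} (q; q)_{n-m})`, which is zero for
`|m| > n`. -/
def centralQBinomial (q : K) (n : ℕ) (m : ℤ) : K :=
  qPochhammer q (2 * n) * (invQPochhammer q (n + m) * invQPochhammer q (n - m))

lemma centralQBinomial_eq_zero (q : K) {n : ℕ} {m : ℤ} (hm : m ∉ Finset.Icc (-n : ℤ) n) :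
    centralQBinomial q n m = 0 := by
  have hm' : (n : ℤ) + m < 0 ∨ (n : ℤ) - m < 0 := by rw [Finset.mem_Icc] at hm; omega
  rcases hm' with h | h <;> simp [centralQBinomial, invQPochhammer_of_neg q h]

lemma tripleProduct_eq_mul_prod_range {p y : K} (hp : p ≠ 0) (hy : y ≠ 0) (n : ℕ) :
    ∏ j ∈ Finset.range n, (1 + p ^ (2 * j + 1) * y⁻¹) * (1 + p ^ (2 * j + 1) * y) =
      p ^ n ^ 2 * (y ^ n)⁻¹ *
        ∏ j ∈ Finset.range (2 * n), (1 + p * y / (p ^ 2) ^ n * (p ^ 2) ^ j) := by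
  have hodd : ∏ j ∈ Finset.range n, p ^ (2 * j + 1) * y⁻¹ = p ^ n ^ 2 * (y ^ n)⁻¹ := by
    have hsum : ∑ j ∈ Finset.range n, (2 * j + 1) = n ^ 2 := by
      induction n with
      | zero => rfl
      | succ n ih => rw [Finset.sum_range_succ, ih]; ring
    rw [Finset.prod_mul_distrib, Finset.prod_pow_eq_pow_sum, hsum, Finset.prod_const,
      Finset.card_range, inv_pow]
  rw [two_mul, Finset.prod_range_add, Finset.prod_mul_distrib, ← mul_assoc, ← hodd]
  congr 1
  · rw [← Finset.prod_range_reflect (fun j => 1 + p * y / (p ^ 2) ^ n * (p ^ 2) ^ j),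
      ← Finset.prod_mul_distrib]
    refine Finset.prod_congr rfl fun j hj => ?_
    obtain ⟨k, rfl⟩ := Nat.exists_eq_add_of_lt (Finset.mem_range.mp hj)
    rw [show j + k + 1 - 1 - j = k by omega]
    field_simp
    ring
  · refine Finset.prod_congr rfl fun j _ => ?_
    have := pow_ne_zero n (pow_ne_zero 2 hp)
    rw [pow_add (p ^ 2)]
    field_simp
    ring

lemma tripleProduct_term {p y : K} (hp : p ≠ 0) (hy : y ≠ 0) (n i : ℕ) :
    p ^ n ^ 2 * (y ^ n)⁻¹ * ((p ^ 2) ^ i.choose 2 * (p * y / (p ^ 2) ^ n) ^ i) =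
      p ^ ((i : ℤ) - n) ^ 2 * y ^ ((i : ℤ) - n) := by
  have hchoose : p ^ (2 * i.choose 2 + i) = p ^ i ^ 2 := by
    rw [Nat.choose_two_right, Nat.mul_div_cancel' (Nat.even_mul_pred_self i).two_dvd]
    rcases i with _ | i
    · simp
    · congr 1
      rw [Nat.add_sub_cancel]
      ring
  rw [zpow_sub₀ hy, show ((i : ℤ) - n) ^ 2 = ((n ^ 2 + i ^ 2 : ℕ) : ℤ) - ((2 * n * i : ℕ) : ℤ) by
    push_cast; ring, zpow_sub₀ hp]
  simp only [zpow_natCast, pow_add, ← hchoose]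
  rw [div_pow, mul_pow p y, show 2 * n * i = 2 * (n * i) by ring, pow_mul p 2 (n * i),
    ← pow_mul (p ^ 2) n i, pow_mul p 2 (i.choose 2)]
  field_simp

lemma tripleProduct_eq_sum {p y : K} (hp : p ≠ 0) (hy : y ≠ 0)
    (hq : ∀ n, qPochhammer (p ^ 2) n ≠ 0) (n : ℕ) :
    ∏ j ∈ Finset.range n, (1 + p ^ (2 * j + 1) * y⁻¹) * (1 + p ^ (2 * j + 1) * y) =
      ∑ m ∈ Finset.Icc (-n : ℤ) n, centralQBinomial (p ^ 2) n m * (p ^ m ^ 2 * y ^ m) := by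
  rw [tripleProduct_eq_mul_prod_range hp hy, prod_range_one_add_mul_pow hq, mul_left_comm,
    Finset.mul_sum, Finset.mul_sum]
  refine Finset.sum_bij' (fun k _ => (k.1 : ℤ) - n)
    (fun m _ => ((n + m).toNat, (n - m).toNat)) ?_ ?_ ?_ ?_ ?_
  · intro k hk
    have := mem_antidiagonal.mp hk
    rw [Finset.mem_Icc]; omega
  · intro m hm
    rw [Finset.mem_Icc] at hm
    rw [mem_antidiagonal]; omega
  · intro k hk
    have := mem_antidiagonal.mp hk
    ext <;> simp only <;> omega
  · intro m hm
    rw [Finset.mem_Icc] at hm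
    simp only; omega
  · intro k hk
    have := mem_antidiagonal.mp hk
    rw [← tripleProduct_term hp hy, centralQBinomial, show (n : ℤ) + (k.1 - n) = k.1 by ring,
      show (n : ℤ) - (k.1 - n) = k.2 by omega, invQPochhammer_natCast, invQPochhammer_natCast]
    ring

end GaussBinomial

section InfiniteProducts

open Filter Topology

variable {ι : Type*} {v : ι → ℂ} {q : ℂ}

lemma multipliable_one_sub (hv : Summable (‖v ·‖)) : Multipliable fun i => 1 - v i := by
  simpa only [sub_eq_add_neg] using
    multipliable_one_add_of_summable (f := fun i => -v i) (by simpa using hv)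

lemma tprod_one_sub_ne_zero (hv : Summable (‖v ·‖)) (h : ∀ i, v i ≠ 1) : ∏' i, (1 - v i) ≠ 0 := by
  simp only [sub_eq_add_neg]
  exact tprod_one_add_ne_zero_of_summable (f := fun i => -v i)
    (fun i => by rw [← sub_eq_add_neg]; exact sub_ne_zero.mpr (h i).symm) (by simpa using hv)

lemma pow_succ_ne_one (hq : ‖q‖ < 1) (n : ℕ) : q ^ (n + 1) ≠ 1 := fun h => by
  have := pow_lt_one₀ (norm_nonneg q) hq n.succ_ne_zero
  rw [← norm_pow, h, norm_one] at this
  exact lt_irrefl _ this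

lemma qPochhammer_ne_zero (hq : ‖q‖ < 1) (n : ℕ) : qPochhammer q n ≠ 0 :=
  Finset.prod_ne_zero_iff.mpr fun i _ => sub_ne_zero.mpr (pow_succ_ne_one hq i).symm

/-- The Euler product `(q; q)_∞`. -/
def eulerProduct (q : ℂ) : ℂ := ∏' n : ℕ, (1 - q ^ (n + 1))

lemma summable_norm_pow_succ (hq : ‖q‖ < 1) : Summable fun n : ℕ => ‖q ^ (n + 1)‖ := by
  simp only [norm_pow]
  exact (summable_nat_add_iff 1).mpr (summable_geometric_of_lt_one (norm_nonneg _) hq)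

lemma eulerProduct_ne_zero (hq : ‖q‖ < 1) : eulerProduct q ≠ 0 :=
  tprod_one_sub_ne_zero (summable_norm_pow_succ hq) (pow_succ_ne_one hq)

lemma tendsto_qPochhammer (hq : ‖q‖ < 1) :
    Tendsto (qPochhammer q) atTop (𝓝 (eulerProduct q)) :=
  (multipliable_one_sub (summable_norm_pow_succ hq)).hasProd.tendsto_prod_nat

lemma exists_norm_invQPochhammer_le (hq : ‖q‖ < 1) :
    ∃ B, 0 ≤ B ∧ ∀ k, ‖invQPochhammer q k‖ ≤ B := by
  have hlim := (tendsto_qPochhammer hq).inv₀ (eulerProduct_ne_zero hq)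
  obtain ⟨B, hB⟩ := (Metric.isBounded_range_of_tendsto _ hlim).exists_norm_le
  have hB₀ : 0 ≤ B := (norm_nonneg _).trans (hB _ ⟨0, rfl⟩)
  refine ⟨B, hB₀, fun k => ?_⟩
  rw [invQPochhammer]
  split_ifs
  · exact hB _ ⟨k.toNat, rfl⟩
  · rwa [norm_zero]

lemma tendsto_invQPochhammer (hq : ‖q‖ < 1) :
    Tendsto (invQPochhammer q) atTop (𝓝 (eulerProduct q)⁻¹) := by
  have htoNat : Tendsto Int.toNat atTop atTop :=
    tendsto_atTop.mpr fun n => (eventually_ge_atTop (n : ℤ)).mono fun k hk => by omega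
  refine (((tendsto_qPochhammer hq).inv₀ (eulerProduct_ne_zero hq)).comp htoNat).congr' ?_
  filter_upwards [eventually_ge_atTop 0] with k hk
  rw [invQPochhammer, if_pos hk, Function.comp_apply]

lemma tendsto_centralQBinomial (hq : ‖q‖ < 1) (m : ℤ) :
    Tendsto (fun n => centralQBinomial q n m) atTop (𝓝 (eulerProduct q)⁻¹) := by
  have hE := eulerProduct_ne_zero hq
  have hcast := tendsto_natCast_atTop_atTop (R := ℤ)
  rw [show (eulerProduct q)⁻¹ =
    eulerProduct q * ((eulerProduct q)⁻¹ * (eulerProduct q)⁻¹) by field_simp]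
  exact ((tendsto_qPochhammer hq).comp (tendsto_id.const_mul_atTop' two_pos)).mul
    (((tendsto_invQPochhammer hq).comp (tendsto_atTop_add_const_right _ m hcast)).mul
      ((tendsto_invQPochhammer hq).comp (tendsto_atTop_add_const_right _ (-m) hcast)))

lemma exists_norm_centralQBinomial_le (hq : ‖q‖ < 1) :
    ∃ B, ∀ n m, ‖centralQBinomial q n m‖ ≤ B := by
  obtain ⟨B, hB⟩ := (Metric.isBounded_range_of_tendsto _ (tendsto_qPochhammer hq)).exists_norm_le
  obtain ⟨B', hB'₀, hB'⟩ := exists_norm_invQPochhammer_le hq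
  have hB₀ : 0 ≤ B := (norm_nonneg _).trans (hB _ ⟨0, rfl⟩)
  refine ⟨B * (B' * B'), fun n m => ?_⟩
  rw [centralQBinomial, norm_mul, norm_mul]
  gcongr
  exacts [hB _ ⟨_, rfl⟩, hB' _, hB' _]

lemma norm_exp_two_pi_I_mul_lt_one {τ : ℂ} (hτ : 0 < τ.im) : ‖exp (2 * Real.pi * I * τ)‖ < 1 :=
  UpperHalfPlane.norm_exp_two_pi_I_lt_one ⟨τ, hτ⟩

lemma jacobiTheta₂_term_eq (m : ℤ) (z τ : ℂ) :
    jacobiTheta₂_term m z τ = exp (Real.pi * I * τ) ^ m ^ 2 * exp (2 * Real.pi * I * z) ^ m := by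
  rw [jacobiTheta₂_term, ← Complex.exp_int_mul, ← Complex.exp_int_mul, ← Complex.exp_add]
  congr 1
  push_cast
  ring

lemma exp_pi_I_mul_sq (τ : ℂ) : exp (Real.pi * I * τ) ^ 2 = exp (2 * Real.pi * I * τ) := by
  rw [← Complex.exp_nat_mul]
  congr 1
  push_cast
  ring

lemma tendsto_tripleProduct {τ : ℂ} (hτ : 0 < τ.im) (z : ℂ) :
    Tendsto (fun n => ∏ j ∈ Finset.range n,
      (1 + exp (Real.pi * I * τ) ^ (2 * j + 1) * (exp (2 * Real.pi * I * z))⁻¹) *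
        (1 + exp (Real.pi * I * τ) ^ (2 * j + 1) * exp (2 * Real.pi * I * z)))
      atTop (𝓝 ((eulerProduct (exp (2 * Real.pi * I * τ)))⁻¹ * jacobiTheta₂ z τ)) := by
  have hq := norm_exp_two_pi_I_mul_lt_one hτ
  obtain ⟨B, hB⟩ := exists_norm_centralQBinomial_le hq
  have hlim := tendsto_tsum_of_dominated_convergence
    (((summable_jacobiTheta₂_term_iff z τ).mpr hτ).norm.mul_left B)
    (fun m => (tendsto_centralQBinomial hq m).mul_const (jacobiTheta₂_term m z τ))
    (Eventually.of_forall fun n m => by rw [norm_mul]; gcongr; exact hB n m)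
  rw [jacobiTheta₂, ← tsum_mul_left]
  refine hlim.congr fun n => ?_
  rw [← exp_pi_I_mul_sq] at hq ⊢
  rw [tripleProduct_eq_sum (Complex.exp_ne_zero _) (Complex.exp_ne_zero _) (qPochhammer_ne_zero hq)]
  simp only [jacobiTheta₂_term_eq]
  exact tsum_eq_sum fun m hm => by rw [centralQBinomial_eq_zero _ hm, zero_mul]

end InfiniteProducts

/-! ### The theta function -/

section Theta

open Filter Topology

variable {τ : ℂ}

lemma summable_norm_exp_mul_add (hτ : 0 < τ.im) (z : ℂ) :
    Summable fun j : ℕ => ‖exp (2 * Real.pi * I * (j * τ + z))‖ := by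
  have hgeom (j : ℕ) : ‖exp (2 * Real.pi * I * (j * τ + z))‖ =
      ‖exp (2 * Real.pi * I * z)‖ * ‖exp (2 * Real.pi * I * τ)‖ ^ j := by
    rw [← norm_pow, ← norm_mul, ← Complex.exp_nat_mul, ← Complex.exp_add]
    congr 2
    ring
  simp only [hgeom]
  exact (summable_geometric_of_lt_one (norm_nonneg _)
    (norm_exp_two_pi_I_mul_lt_one hτ)).mul_left _

lemma summable_norm_exp_succ_mul_sub (hτ : 0 < τ.im) (z : ℂ) :
    Summable fun j : ℕ => ‖exp (2 * Real.pi * I * ((j + 1) * τ - z))‖ := by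
  refine (summable_norm_exp_mul_add hτ (τ - z)).congr fun j => ?_
  congr 3
  ring

lemma theta0_eq_mul (hτ : 0 < τ.im) (z : ℂ) :
    theta0 z τ = (∏' j : ℕ, (1 - exp (2 * Real.pi * I * ((j + 1) * τ - z)))) *
      ∏' j : ℕ, (1 - exp (2 * Real.pi * I * (j * τ + z))) :=
  (multipliable_one_sub (summable_norm_exp_succ_mul_sub hτ z)).tprod_mul
    (multipliable_one_sub (summable_norm_exp_mul_add hτ z))

lemma theta0_mul_eulerProduct (hτ : 0 < τ.im) (z : ℂ) :
    theta0 z τ * eulerProduct (exp (2 * Real.pi * I * τ)) =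
      jacobiTheta₂ (z - τ / 2 + 1 / 2) τ := by
  have hprod := ((multipliable_one_sub (summable_norm_exp_succ_mul_sub hτ z)).mul
    (multipliable_one_sub (summable_norm_exp_mul_add hτ z))).hasProd.tendsto_prod_nat
  have htheta := tendsto_nhds_unique (hprod.congr fun n => Finset.prod_congr rfl fun j _ => ?_)
    (tendsto_tripleProduct hτ (z - τ / 2 + 1 / 2))
  · rw [theta0, htheta, mul_right_comm, inv_mul_cancel₀, one_mul]
    exact eulerProduct_ne_zero (norm_exp_two_pi_I_mul_lt_one hτ)
  · have hright : exp (Real.pi * I * τ) ^ (2 * j + 1) *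
        exp (2 * Real.pi * I * (z - τ / 2 + 1 / 2)) = -exp (2 * Real.pi * I * (j * τ + z)) := by
      rw [← Complex.exp_antiperiodic, ← Complex.exp_nat_mul, ← Complex.exp_add]
      congr 1
      push_cast
      ring
    have hleft : exp (Real.pi * I * τ) ^ (2 * j + 1) *
        (exp (2 * Real.pi * I * (z - τ / 2 + 1 / 2)))⁻¹ =
          -exp (2 * Real.pi * I * ((j + 1) * τ - z)) := by
      rw [← Complex.exp_antiperiodic.sub_eq, ← Complex.exp_nat_mul, ← Complex.exp_neg,
        ← Complex.exp_add]
      congr 1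
      push_cast
      ring
    rw [hleft, hright, ← sub_eq_add_neg, ← sub_eq_add_neg]

end Theta

section Modularity

variable {τ : ℂ}

lemma ne_zero_of_im_pos (hτ : 0 < τ.im) : τ ≠ 0 := by
  rintro rfl
  simp at hτ

lemma theta0_add_one_right (z τ : ℂ) : theta0 z (τ + 1) = theta0 z τ := by
  rw [theta0, theta0]
  refine tprod_congr fun j => ?_
  congr 2 <;> rw [Complex.exp_eq_exp_iff_exists_int]
  exacts [⟨j + 1, by push_cast; ring⟩, ⟨j, by push_cast; ring⟩]

lemma theta0_add_intCast (z τ : ℂ) (n : ℤ) : theta0 (z + n) τ = theta0 z τ := by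
  rw [theta0, theta0]
  refine tprod_congr fun j => ?_
  congr 2 <;> rw [Complex.exp_eq_exp_iff_exists_int]
  exacts [⟨-n, by push_cast; ring⟩, ⟨n, by ring⟩]

lemma theta0_add_tau (hτ : 0 < τ.im) (z : ℂ) :
    theta0 (z + τ) τ = exp (Real.pi * I * (1 - 2 * z)) * theta0 z τ := by
  apply mul_right_cancel₀ (eulerProduct_ne_zero (norm_exp_two_pi_I_mul_lt_one hτ))
  rw [mul_assoc _ (theta0 z τ), theta0_mul_eulerProduct hτ, theta0_mul_eulerProduct hτ,
    show z + τ - τ / 2 + 1 / 2 = z - τ / 2 + 1 / 2 + τ by ring, jacobiTheta₂_add_left']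
  congr 1
  rw [Complex.exp_eq_exp_iff_exists_int]
  exact ⟨-1, by push_cast; ring⟩

lemma theta0_add_int_mul_tau (hτ : 0 < τ.im) (z : ℂ) (n : ℤ) :
    theta0 (z + n * τ) τ = exp (Real.pi * I * (n - 2 * n * z - n * (n - 1) * τ)) * theta0 z τ := by
  induction n using Int.induction_on with
  | zero => simp
  | succ n ih =>
    rw [show z + ((n + 1 : ℤ) : ℂ) * τ = z + (n : ℤ) * τ + τ by push_cast; ring,
      theta0_add_tau hτ, ih, ← mul_assoc, ← Complex.exp_add]
    congr 2
    push_cast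
    ring
  | pred n ih =>
    apply mul_left_cancel₀ (Complex.exp_ne_zero _)
    rw [← theta0_add_tau hτ,
      show z + ((-n - 1 : ℤ) : ℂ) * τ + τ = z + (-n : ℤ) * τ by push_cast; ring, ih,
      ← mul_assoc, ← Complex.exp_add]
    congr 2
    push_cast
    ring

lemma inv_sqrt_I_mul_sqrt (hτ : 0 < τ.im) : (sqrt I)⁻¹ * sqrt τ = (-I * τ) ^ (1 / 2 : ℂ) := by
  have hτ₀ := ne_zero_of_im_pos hτ
  have hI := neg_ne_zero.mpr I_ne_zero
  have harg : arg (-I) + arg τ ∈ Set.Ioc (-Real.pi) Real.pi := by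
    have := Complex.arg_nonneg_iff.mpr hτ.le
    have := Complex.arg_le_pi τ
    have := Real.pi_pos
    rw [Complex.arg_neg_I]
    constructor <;> linarith
  rw [sqrt_eq_exp hτ₀, sqrt_eq_exp I_ne_zero, Complex.cpow_def_of_ne_zero (mul_ne_zero hI hτ₀),
    Complex.log_mul hI hτ₀ harg, Complex.log_neg_I, Complex.log_I, ← Complex.exp_neg,
    ← Complex.exp_add]
  congr 1
  ring

lemma im_neg_one_div_pos (hτ : 0 < τ.im) : 0 < (-1 / τ).im := by
  rw [neg_div, neg_im, one_div, inv_im, neg_div, neg_neg]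
  exact div_pos hτ (normSq_pos.mpr (ne_zero_of_im_pos hτ))

lemma eta_eq_exp_mul_eulerProduct (τ : ℂ) : ModularForm.eta τ =
    exp (Real.pi * I * (τ / 12)) * eulerProduct (exp (2 * Real.pi * I * τ)) := by
  rw [ModularForm.eta, eulerProduct, Function.Periodic.qParam]
  simp only [ModularForm.eta_q_eq_pow]
  congr 2
  push_cast
  ring

lemma eulerProduct_neg_one_div (hτ : 0 < τ.im) :
    eulerProduct (exp (2 * Real.pi * I * (-1 / τ))) =
      (-I * τ) ^ (1 / 2 : ℂ) * exp (Real.pi * I * (τ / 12 + 1 / (12 * τ))) *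
        eulerProduct (exp (2 * Real.pi * I * τ)) := by
  have hη : ModularForm.eta (-1 / τ) = (sqrt I)⁻¹ * (sqrt τ * ModularForm.eta τ) := by
    simpa using ModularForm.eta_comp_eq_csqrt_I_inv hτ
  rw [← mul_assoc, inv_sqrt_I_mul_sqrt hτ, eta_eq_exp_mul_eulerProduct,
    eta_eq_exp_mul_eulerProduct] at hη
  have hexp : exp (Real.pi * I * (τ / 12)) =
      exp (Real.pi * I * (-1 / τ / 12)) * exp (Real.pi * I * (τ / 12 + 1 / (12 * τ))) := by
    rw [← Complex.exp_add]
    congr 1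
    have := ne_zero_of_im_pos hτ
    field_simp
    ring
  apply mul_left_cancel₀ (Complex.exp_ne_zero (Real.pi * I * (-1 / τ / 12)))
  rw [hη, hexp]
  ring

lemma theta0_neg_one_div (hτ : 0 < τ.im) (z : ℂ) :
    theta0 (z / τ) (-1 / τ) =
      exp (Real.pi * I * (z ^ 2 / τ - z + z / τ + τ / 6 + 1 / (6 * τ) - 1 / 2)) * theta0 z τ := by
  have hτ₀ := ne_zero_of_im_pos hτ
  have hE := eulerProduct_ne_zero (norm_exp_two_pi_I_mul_lt_one hτ)
  have hsqrt : (-I * τ) ^ (1 / 2 : ℂ) ≠ 0 := by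
    rw [Ne, Complex.cpow_eq_zero_iff]
    exact fun h => mul_ne_zero (neg_ne_zero.mpr I_ne_zero) hτ₀ h.1
  have hinv := theta0_mul_eulerProduct (im_neg_one_div_pos hτ) (z / τ)
  rw [show z / τ - -1 / τ / 2 + 1 / 2 = (z - τ / 2 + 1 / 2) / τ + 1 by field_simp; ring,
    jacobiTheta₂_add_left, eulerProduct_neg_one_div hτ] at hinv
  have hθ := theta0_mul_eulerProduct hτ z
  rw [jacobiTheta₂_functional_equation, ← hinv] at hθ
  have hexp : exp (Real.pi * I * (z ^ 2 / τ - z + z / τ + τ / 6 + 1 / (6 * τ) - 1 / 2)) *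
      exp (-Real.pi * I * (z - τ / 2 + 1 / 2) ^ 2 / τ) *
        exp (Real.pi * I * (τ / 12 + 1 / (12 * τ))) = 1 := by
    rw [← Complex.exp_add, ← Complex.exp_add]
    convert Complex.exp_zero using 2
    field_simp
    ring
  have hθ' : theta0 z τ = exp (-Real.pi * I * (z - τ / 2 + 1 / 2) ^ 2 / τ) *
      exp (Real.pi * I * (τ / 12 + 1 / (12 * τ))) * theta0 (z / τ) (-1 / τ) := by
    apply mul_right_cancel₀ hE
    rw [hθ]
    field_simp [hsqrt]
  rw [hθ']
  linear_combination (-theta0 (z / τ) (-1 / τ)) * hexp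

end Modularity

/-! ### Equality up to exponentials of quadratic polynomials -/

/-- `F` and `G` agree over `U` up to a factor `exp (π i φ)` with an exponent `φ` which is
polynomial in `w`. -/
def ExpEquiv (U : Set (Fin 3 → ℂ)) (F G : (Fin 3 → ℂ) → ℂ → ℂ) : Prop :=
  ∃ φ ∈ exponents U, ∀ x ∈ U, ∀ w, F x w = exp (Real.pi * I * φ x w) * G x w

namespace ExpEquiv

variable {U : Set (Fin 3 → ℂ)} {F F' G G' H : (Fin 3 → ℂ) → ℂ → ℂ}

lemma refl (F : (Fin 3 → ℂ) → ℂ → ℂ) : ExpEquiv U F F :=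
  ⟨0, zero_mem _, by simp⟩

lemma symm : ExpEquiv U F G → ExpEquiv U G F := by
  rintro ⟨φ, hφ, h⟩
  refine ⟨-φ, neg_mem hφ, fun x hx w => ?_⟩
  rw [h x hx w, ← mul_assoc, ← Complex.exp_add]
  simp

lemma trans : ExpEquiv U F G → ExpEquiv U G H → ExpEquiv U F H := by
  rintro ⟨φ, hφ, h⟩ ⟨ψ, hψ, h'⟩
  refine ⟨φ + ψ, add_mem hφ hψ, fun x hx w => ?_⟩
  rw [h x hx w, h' x hx w, ← mul_assoc, ← Complex.exp_add, ← mul_add]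
  rfl

lemma mul : ExpEquiv U F G → ExpEquiv U F' G' → ExpEquiv U (F * F') (G * G') := by
  rintro ⟨φ, hφ, h⟩ ⟨ψ, hψ, h'⟩
  refine ⟨φ + ψ, add_mem hφ hψ, fun x hx w => ?_⟩
  simp only [Pi.mul_apply, Pi.add_apply, h x hx w, h' x hx w, mul_add, Complex.exp_add]
  ring

lemma inv : ExpEquiv U F G → ExpEquiv U F⁻¹ G⁻¹ := by
  rintro ⟨φ, hφ, h⟩
  refine ⟨-φ, neg_mem hφ, fun x hx w => ?_⟩
  simp only [Pi.inv_apply, Pi.neg_apply, h x hx w, mul_inv, mul_neg, Complex.exp_neg]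

lemma div (h : ExpEquiv U F G) (h' : ExpEquiv U F' G') : ExpEquiv U (F / F') (G / G') := by
  rw [div_eq_mul_inv, div_eq_mul_inv]
  exact h.mul h'.inv

lemma prod {ι : Type*} (s : Finset ι) {F G : ι → (Fin 3 → ℂ) → ℂ → ℂ}
    (h : ∀ i ∈ s, ExpEquiv U (F i) (G i)) : ExpEquiv U (∏ i ∈ s, F i) (∏ i ∈ s, G i) := by
  classical
  induction s using Finset.induction_on with
  | empty => exact refl 1
  | insert i s hi ih =>
    rw [Finset.prod_insert hi, Finset.prod_insert hi]
    exact (h i (Finset.mem_insert_self i s)).mul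
      (ih fun j hj => h j (Finset.mem_insert_of_mem hj))

lemma shift (δ : DualLattice3) : ExpEquiv U F G →
    ExpEquiv U (fun x w => F x (w + ev δ x)) (fun x w => G x (w + ev δ x)) := by
  rintro ⟨φ, hφ, h⟩
  exact ⟨_, shift_mem_exponents δ hφ, fun x hx w => h x hx _⟩

end ExpEquiv

/-! ### Orientation -/

section CrossProduct

variable {R : Type*} [CommRing R]

lemma triple_product_smul (u v w x : Fin 3 → R) :
    (u ⬝ᵥ v ⨯₃ w) • x = (x ⬝ᵥ v ⨯₃ w) • u + (x ⬝ᵥ w ⨯₃ u) • v + (x ⬝ᵥ u ⨯₃ v) • w := by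
  ext i
  fin_cases i <;> simp [cross_apply, dotProduct, Fin.sum_univ_three] <;> ring

lemma triple_product_smul_eq_smul_cross (u v w x : Fin 3 → R) :
    (u ⬝ᵥ v ⨯₃ w) • x = (u ⬝ᵥ x) • v ⨯₃ w + (v ⬝ᵥ x) • w ⨯₃ u + (w ⬝ᵥ x) • u ⨯₃ v := by
  ext i
  fin_cases i <;> simp [cross_apply, dotProduct, Fin.sum_univ_three] <;> ring

lemma crossProduct_mul (g : Matrix (Fin 2) (Fin 2) R) (e : Matrix (Fin 2) (Fin 3) R) :
    (g * e) 0 ⨯₃ (g * e) 1 = g.det • e 0 ⨯₃ e 1 := by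
  ext i
  fin_cases i <;> simp [cross_apply, Matrix.mul_apply, Matrix.det_fin_two, Fin.sum_univ_two] <;>
    ring

end CrossProduct

lemma im_sum_mul_conj_sum (α β : Fin 3 → ℝ) (x : Fin 3 → ℂ) :
    ((∑ i, (α i : ℂ) * x i) * (starRingEnd ℂ) (∑ i, (β i : ℂ) * x i)).im =
      α ⨯₃ β ⬝ᵥ (fun i => (x i).im) ⨯₃ (fun i => (x i).re) := by
  rw [cross_dot_cross]
  simp [dotProduct]
  ring

/-- The real number `a · (Im x × Re x)`, whose sign decides whether `x ∈ U_a^+`. -/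
def orientedVolume (a : Lattice3) (x : Fin 3 → ℂ) : ℝ :=
  (fun i => (a i : ℝ)) ⬝ᵥ (fun i => (x i).im) ⨯₃ (fun i => (x i).re)

lemma orientedVolume_pos {a : Lattice3} (ha : a ≠ 0) {x : Fin 3 → ℂ} (hx : x ∈ domain a) :
    0 < orientedVolume a x := by
  obtain ⟨α, β, ⟨hα, hβ, -, hdet⟩, him⟩ := hx
  let toReal (v : Fin 3 → ℚ) : Fin 3 → ℝ := fun i => (v i : ℝ)
  set c : Fin 3 → ℚ := fun i => (a i : ℚ) with hc
  have hcc : 0 < c ⬝ᵥ c := by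
    refine lt_of_le_of_ne (Finset.sum_nonneg fun i _ => mul_self_nonneg _) fun h => ha ?_
    ext i
    simpa [hc] using congrFun (dotProduct_self_eq_zero.mp h.symm) i
  have hcross : (c ⬝ᵥ c) • α ⨯₃ β = (c ⬝ᵥ α ⨯₃ β) • c := by
    rw [triple_product_smul_eq_smul_cross, show α ⬝ᵥ c = 0 from hα, show β ⬝ᵥ c = 0 from hβ]
    simp
  have hdet : 0 < c ⬝ᵥ α ⨯₃ β := by
    rw [triple_product_permutation, triple_product_eq_det]
    exact hdet c hcc
  have hcrossR : ((c ⬝ᵥ c : ℚ) : ℝ) • (toReal α ⨯₃ toReal β) =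
      ((c ⬝ᵥ α ⨯₃ β : ℚ) : ℝ) • fun i => (a i : ℝ) := by
    ext i
    have := congrArg (Rat.cast (K := ℝ)) (congrFun hcross i)
    fin_cases i <;> simpa [cross_apply, toReal, hc] using this
  have him' : 0 < toReal α ⨯₃ toReal β ⬝ᵥ (fun i => (x i).im) ⨯₃ (fun i => (x i).re) := by
    rw [← im_sum_mul_conj_sum]
    simpa [toReal] using him
  have hscaled := congrArg (· ⬝ᵥ (fun i => (x i).im) ⨯₃ (fun i => (x i).re)) hcrossR
  simp only [smul_dotProduct, smul_eq_mul] at hscaled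
  refine (pos_iff_pos_of_mul_pos ?_).mp (Rat.cast_pos.mpr hdet)
  exact hscaled ▸ mul_pos (Rat.cast_pos.mpr hcc) him'

section OrientedPairs

variable {a : Lattice3} {α β δ δ₀ : DualLattice3} {x : Fin 3 → ℂ}

lemma pair_eq_dotProduct (δ : DualLattice3) (a : Lattice3) : pair δ a = δ ⬝ᵥ a := rfl

lemma pair_add (δ ε : DualLattice3) (a : Lattice3) : pair (δ + ε) a = pair δ a + pair ε a :=
  add_dotProduct ..

lemma pair_neg (δ : DualLattice3) (a : Lattice3) : pair (-δ) a = -pair δ a :=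
  neg_dotProduct ..

lemma pair_sub (δ ε : DualLattice3) (a : Lattice3) : pair (δ - ε) a = pair δ a - pair ε a :=
  sub_dotProduct ..

lemma pair_zsmul (n : ℤ) (δ : DualLattice3) (a : Lattice3) : pair (n • δ) a = n * pair δ a :=
  smul_dotProduct ..

lemma ev_neg (δ : DualLattice3) (x : Fin 3 → ℂ) : ev (-δ) x = -ev δ x := by
  simp [ev]

lemma ev_sub (δ ε : DualLattice3) (x : Fin 3 → ℂ) : ev (δ - ε) x = ev δ x - ev ε x := by
  rw [sub_eq_add_neg, ev_add, ev_neg, sub_eq_add_neg]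

lemma ne_zero_of_pair_eq_one (h₀ : pair δ₀ a = 1) : a ≠ 0 := by
  rintro rfl
  simp [pair] at h₀

lemma pair_left (h : α ⨯₃ β = a) : pair α a = 0 :=
  h ▸ dot_self_cross α β

lemma pair_right (h : α ⨯₃ β = a) : pair β a = 0 :=
  h ▸ dot_cross_self α β

lemma im_ev_mul_conj (h : α ⨯₃ β = a) (x : Fin 3 → ℂ) :
    (ev α x * (starRingEnd ℂ) (ev β x)).im = orientedVolume a x := by
  subst h
  have := im_sum_mul_conj_sum (fun i => (α i : ℝ)) (fun i => (β i : ℝ)) x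
  simp only [ofReal_intCast] at this
  rw [ev, ev, this, orientedVolume]
  congr 1
  ext i
  fin_cases i <;> simp [cross_apply]

lemma ev_left_ne_zero (h : α ⨯₃ β = a) (hx : 0 < orientedVolume a x) : ev α x ≠ 0 := by
  rintro hα
  simp [← im_ev_mul_conj h, hα] at hx

lemma ev_right_ne_zero (h : α ⨯₃ β = a) (hx : 0 < orientedVolume a x) : ev β x ≠ 0 := by
  rintro hβ
  simp [← im_ev_mul_conj h, hβ] at hx

lemma im_ev_div_pos (h : α ⨯₃ β = a) (hx : 0 < orientedVolume a x) :
    0 < (ev α x / ev β x).im := by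
  rw [show (ev α x / ev β x).im = orientedVolume a x / normSq (ev β x) by
    rw [← im_ev_mul_conj h, Complex.div_im, mul_im, conj_re, conj_im]; ring]
  exact div_pos hx (normSq_pos.mpr (ev_right_ne_zero h hx))

lemma exists_eq_zsmul_add_zsmul (h : α ⨯₃ β = a) (h₀ : pair δ₀ a = 1) (hδ : pair δ a = 0) :
    ∃ p q : ℤ, δ = p • α + q • β := by
  subst h
  have := triple_product_smul δ₀ α β δ
  rw [← pair_eq_dotProduct, h₀, one_smul, ← pair_eq_dotProduct, hδ, zero_smul, zero_add] at this
  exact ⟨_, _, this⟩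

lemma cross_eq_of_basis (e : Module.Basis (Fin 3) ℤ DualLattice3)
    (hdet : 0 < Matrix.det (Matrix.of fun i => e i)) (h0 : pair (e 0) a = 1)
    (h1 : pair (e 1) a = 0) (h2 : pair (e 2) a = 0) : e 1 ⨯₃ e 2 = a := by
  have hunit : IsUnit (Matrix.det (Matrix.of fun i => e i)) := by
    simpa only [Pi.basisFun_det_apply] using (Pi.basisFun ℤ (Fin 3)).isUnit_det e
  have htriple : e 0 ⬝ᵥ e 1 ⨯₃ e 2 = 1 := by
    rw [triple_product_eq_det, show ![e 0, e 1, e 2] = fun i => e i from List.ofFn_inj.mp rfl]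
    exact (Int.isUnit_iff.mp hunit).resolve_right fun h => by rw [h] at hdet; omega
  have := triple_product_smul_eq_smul_cross (e 0) (e 1) (e 2) a
  simp only [← pair_eq_dotProduct, h0, h1, h2, zero_smul, add_zero, one_smul] at this
  rw [← this, pair_eq_dotProduct, htriple, one_smul]

end OrientedPairs

/-! ### Invariance of the theta functions of a plane -/

/-- The theta function `θ₀(w/β(x), α(x)/β(x))` of an oriented basis `(α, β)` of `H(a) ∩ Λ^∨`. -/
def planeTheta (α β : DualLattice3) (x : Fin 3 → ℂ) (w : ℂ) : ℂ :=
  theta0 (w / ev β x) (ev α x / ev β x)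

section PlaneTheta

variable {U : Set (Fin 3 → ℂ)} {a : Lattice3} {α β α' β' δ ε δ₀ : DualLattice3}

lemma inv_ev_left_mem_ratFun (ha : a ≠ 0) (h : α ⨯₃ β = a)
    (hU : ∀ x ∈ U, 0 < orientedVolume a x) : (ev α)⁻¹ ∈ ratFun U (-1) :=
  inv_ev_mem_ratFun (by rintro rfl; simp at h; exact ha h.symm) fun x hx =>
    ev_left_ne_zero h (hU x hx)

lemma inv_ev_right_mem_ratFun (ha : a ≠ 0) (h : α ⨯₃ β = a)
    (hU : ∀ x ∈ U, 0 < orientedVolume a x) : (ev β)⁻¹ ∈ ratFun U (-1) :=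
  inv_ev_mem_ratFun (by rintro rfl; simp at h; exact ha h.symm) fun x hx =>
    ev_right_ne_zero h (hU x hx)

lemma planeTheta_translate_equiv (h : α ⨯₃ β = a) (hU : ∀ x ∈ U, 0 < orientedVolume a x) :
    ExpEquiv U (planeTheta (α + β) β) (planeTheta α β) := by
  refine ⟨0, zero_mem _, fun x hx w => ?_⟩
  rw [planeTheta, planeTheta, ev_add, add_div, div_self (ev_right_ne_zero h (hU x hx)),
    theta0_add_one_right]
  simp

lemma planeTheta_invert_equiv (ha : a ≠ 0) (h : α ⨯₃ β = a)
    (hU : ∀ x ∈ U, 0 < orientedVolume a x) :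
    ExpEquiv U (planeTheta (-β) α) (planeTheta α β) := by
  have hα := inv_ev_left_mem_ratFun ha h hU
  have hβ := inv_ev_right_mem_ratFun ha h hU
  have h₀ : (1 / 6 : ℚ) • (ev α * (ev β)⁻¹ + ev β * (ev α)⁻¹) - (fun _ => ((1 / 2 : ℚ) : ℂ)) ∈
      ratFun U 0 :=
    sub_mem (Submodule.smul_mem _ _ (add_mem (mul_mem_ratFun (ev_mem_ratFun α) hβ)
      (mul_mem_ratFun (ev_mem_ratFun β) hα))) (const_mem_ratFun _)
  refine ⟨_, add_mem (add_mem (ratFun_mul_sq_mem_exponents (mul_mem_ratFun hα hβ))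
    (ratFun_mul_mem_exponents (sub_mem hα hβ))) (ratFun_mem_exponents h₀), fun x hx w => ?_⟩
  have hαx := ev_left_ne_zero h (hU x hx)
  have hβx := ev_right_ne_zero h (hU x hx)
  have hinv := theta0_neg_one_div (im_ev_div_pos h (hU x hx)) (w / ev β x)
  rw [show w / ev β x / (ev α x / ev β x) = w / ev α x by field_simp,
    show -1 / (ev α x / ev β x) = ev (-β) x / ev α x by rw [ev_neg]; field_simp] at hinv
  rw [planeTheta, hinv, planeTheta]
  congr 3
  simp [Rat.smul_def]
  field_simp
  ring

lemma planeTheta_specialLinear_equiv (ha : a ≠ 0) (hU : ∀ x ∈ U, 0 < orientedVolume a x)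
    (g : Matrix.SpecialLinearGroup (Fin 2) ℤ) (e : Matrix (Fin 2) (Fin 3) ℤ)
    (h : e 0 ⨯₃ e 1 = a) :
    ExpEquiv U (planeTheta ((g.1 * e) 0) ((g.1 * e) 1)) (planeTheta (e 0) (e 1)) := by
  have hg : g ∈ Subgroup.closure {ModularGroup.S, ModularGroup.T} := by
    simp [SpecialLinearGroup.SL2Z_generators]
  have hcross (g : Matrix.SpecialLinearGroup (Fin 2) ℤ) {e : Matrix (Fin 2) (Fin 3) ℤ}
      (h : e 0 ⨯₃ e 1 = a) : (g.1 * e) 0 ⨯₃ (g.1 * e) 1 = a := by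
    rw [crossProduct_mul, g.2, one_smul, h]
  induction hg using Subgroup.closure_induction generalizing e with
  | mem g hg =>
    have hrow (i : Fin 2) : (g.1 * e) i = g.1 i 0 • e 0 + g.1 i 1 • e 1 := by
      ext j
      simp [Matrix.mul_apply]
    rw [hrow, hrow]
    rcases hg with rfl | rfl
    · simpa [ModularGroup.S] using planeTheta_invert_equiv ha h hU
    · simpa [ModularGroup.T] using planeTheta_translate_equiv h hU
  | one => simpa using .refl _
  | mul g g' _ _ ih ih' =>
    rw [Matrix.SpecialLinearGroup.coe_mul, Matrix.mul_assoc]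
    exact (ih _ (hcross g' h)).trans (ih' e h)
  | inv g _ ih =>
    have := ih _ (hcross g⁻¹ h)
    rw [← Matrix.mul_assoc, ← Matrix.SpecialLinearGroup.coe_mul, mul_inv_cancel,
      Matrix.SpecialLinearGroup.coe_one, Matrix.one_mul] at this
    exact this.symm

lemma planeTheta_equiv (h₀ : pair δ₀ a = 1) (hU : ∀ x ∈ U, 0 < orientedVolume a x)
    (h : α ⨯₃ β = a) (h' : α' ⨯₃ β' = a) : ExpEquiv U (planeTheta α β) (planeTheta α' β') := by
  have ha := ne_zero_of_pair_eq_one h₀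
  obtain ⟨p, q, rfl⟩ := exists_eq_zsmul_add_zsmul h' h₀ (pair_left h)
  obtain ⟨r, s, rfl⟩ := exists_eq_zsmul_add_zsmul h' h₀ (pair_right h)
  have hmul (i : Fin 2) : (!![p, q; r, s] * Matrix.of ![α', β']) i =
      ![p • α' + q • β', r • α' + s • β'] i := by
    ext j
    fin_cases i <;> simp [Matrix.mul_apply]
  have hdet : (!![p, q; r, s]).det • a = a := by
    have := crossProduct_mul !![p, q; r, s] (Matrix.of ![α', β'])
    rw [hmul, hmul] at this
    exact (congrArg _ h').symm.trans (this.symm.trans h)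
  obtain ⟨i, hi⟩ := Function.ne_iff.mp ha
  have hone : (!![p, q; r, s]).det = 1 :=
    mul_right_cancel₀ hi ((congrFun hdet i).trans (one_mul _).symm)
  have := planeTheta_specialLinear_equiv ha hU ⟨_, hone⟩ (Matrix.of ![α', β']) h'
  rwa [hmul, hmul] at this

lemma planeTheta_add_combination_equiv (ha : a ≠ 0) (hU : ∀ x ∈ U, 0 < orientedVolume a x)
    (h : α ⨯₃ β = a) (p q : ℤ) :
    ExpEquiv U (fun x w => planeTheta α β x (w + ev (p • α + q • β) x)) (planeTheta α β) := by
  have hβ := inv_ev_right_mem_ratFun ha h hU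
  have h₀ : (fun _ => ((p : ℚ) : ℂ)) - (p * (p - 1) : ℚ) • (ev α * (ev β)⁻¹) ∈ ratFun U 0 :=
    sub_mem (const_mem_ratFun _) (Submodule.smul_mem _ _ (mul_mem_ratFun (ev_mem_ratFun α) hβ))
  refine ⟨_, sub_mem (ratFun_mem_exponents h₀) (ratFun_mul_mem_exponents
    (Submodule.smul_mem _ (2 * p : ℚ) hβ)), fun x hx w => ?_⟩
  have hβx := ev_right_ne_zero h (hU x hx)
  change planeTheta α β x (w + ev (p • α + q • β) x) = _
  rw [planeTheta, show (w + ev (p • α + q • β) x) / ev β x =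
      w / ev β x + p * (ev α x / ev β x) + q by
    rw [ev_add, ev_zsmul, ev_zsmul]; field_simp; ring,
    theta0_add_intCast, theta0_add_int_mul_tau (im_ev_div_pos h (hU x hx)), planeTheta]
  congr 3
  simp [Rat.smul_def]
  field_simp
  ring

lemma planeTheta_add_ev_equiv (h₀ : pair δ₀ a = 1) (hU : ∀ x ∈ U, 0 < orientedVolume a x)
    (h : α ⨯₃ β = a) (h' : α' ⨯₃ β' = a) (hδε : pair δ a = pair ε a) :
    ExpEquiv U (fun x w => planeTheta α β x (w + ev δ x))
      (fun x w => planeTheta α' β' x (w + ev ε x)) := by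
  obtain ⟨p, q, hpq⟩ := exists_eq_zsmul_add_zsmul (δ := δ - ε) h h₀ (by
    rw [pair_sub, hδε, sub_self])
  have := ((planeTheta_add_combination_equiv (ne_zero_of_pair_eq_one h₀) hU h p q).trans
    (planeTheta_equiv h₀ hU h h')).shift ε
  simpa only [← hpq, ev_sub, add_assoc, add_sub_cancel] using this

end PlaneTheta

/-! ### Wedges -/

/-- Vectors adapted to a wedge `(a, b)` with direction vector `γ`: `(α, γ)` is an oriented basis of
`H(a) ∩ Λ^∨` and `(β, -γ)` is one of `H(b) ∩ Λ^∨`. -/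
structure IsWedgeFrame (a b : Lattice3) (γ α β : DualLattice3) : Prop where
  cross_left : α ⨯₃ γ = a
  cross_right : β ⨯₃ (-γ) = b
  pair_pos : 0 < pair α b
  unit_left : ∃ δ, pair δ a = 1
  unit_right : ∃ δ, pair δ b = 1

namespace IsWedgeFrame

variable {a b : Lattice3} {γ α β δ ε : DualLattice3} {x : Fin 3 → ℂ}

lemma pair_left_eq_pair_right (h : IsWedgeFrame a b γ α β) : pair α b = pair β a := by
  rw [pair_eq_dotProduct, pair_eq_dotProduct, ← h.cross_left, ← h.cross_right,
    triple_product_permutation, map_neg, LinearMap.neg_apply, cross_anticomm]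

lemma swap (h : IsWedgeFrame a b γ α β) : IsWedgeFrame b a (-γ) β α where
  cross_left := h.cross_right
  cross_right := by rw [neg_neg, h.cross_left]
  pair_pos := h.pair_left_eq_pair_right ▸ h.pair_pos
  unit_left := h.unit_right
  unit_right := h.unit_left

lemma pair_dir_left (h : IsWedgeFrame a b γ α β) : pair γ a = 0 := pair_right h.cross_left

lemma pair_dir_right (h : IsWedgeFrame a b γ α β) : pair γ b = 0 := by
  simpa only [pair_neg, neg_eq_zero] using h.swap.pair_dir_left

lemma exists_eq_add_of_pair_left_eq (h : IsWedgeFrame a b γ α β) (hδ : pair δ a = pair ε a) :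
    ∃ p q : ℤ, δ = ε + p • α + q • γ := by
  obtain ⟨δ₀, hδ₀⟩ := h.unit_left
  obtain ⟨p, q, hpq⟩ := exists_eq_zsmul_add_zsmul (δ := δ - ε) h.cross_left hδ₀ (by
    rw [pair_sub, hδ, sub_self])
  exact ⟨p, q, by rw [add_assoc, ← hpq, add_sub_cancel]⟩

lemma exists_eq_add_of_pair_eq (h : IsWedgeFrame a b γ α β) (hδ : pair δ a = pair ε a)
    (hδ' : pair δ b = pair ε b) : ∃ q : ℤ, δ = ε + q • γ := by
  obtain ⟨p, q, rfl⟩ := h.exists_eq_add_of_pair_left_eq hδ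
  have hp : p = 0 := by
    rw [pair_add, pair_add, pair_zsmul, pair_zsmul, h.pair_dir_right] at hδ'
    simpa [h.pair_pos.ne'] using hδ'
  exact ⟨q, by rw [hp, zero_smul, add_zero]⟩

lemma exists_pair_smul_eq (h : IsWedgeFrame a b γ α β) (δ : DualLattice3) :
    ∃ k : ℤ, pair α b • δ = pair δ a • β + pair δ b • α + k • γ := by
  have hb : γ ⨯₃ β = b := by
    rw [← h.cross_right, map_neg, cross_anticomm]
  have := triple_product_smul β α γ δ
  rw [h.cross_left, hb] at this
  exact ⟨_, (congrArg (· • δ) h.pair_left_eq_pair_right).trans this⟩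

lemma exists_im_ev_div_eq (h : IsWedgeFrame a b γ α β) (ha : 0 < orientedVolume a x)
    (hb : 0 < orientedVolume b x) : ∃ p q : ℝ, 0 < p ∧ 0 < q ∧
      ∀ δ : DualLattice3, (ev δ x / ev γ x).im = -p * pair δ a + q * pair δ b := by
  have hα := im_ev_div_pos h.cross_left ha
  have hβ := im_ev_div_pos h.cross_right hb
  rw [ev_neg, div_neg, neg_im] at hβ
  have hγ := ev_right_ne_zero h.cross_left ha
  have hs : (0 : ℝ) < pair α b := by exact_mod_cast h.pair_pos
  refine ⟨-(ev β x / ev γ x).im / pair α b, (ev α x / ev γ x).im / pair α b, div_pos hβ hs,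
    div_pos hα hs, fun δ => ?_⟩
  obtain ⟨k, hk⟩ := h.exists_pair_smul_eq δ
  have him := congrArg (fun ε => (ev ε x / ev γ x).im) hk
  simp only [ev_add, ev_zsmul, add_div, mul_div_assoc, div_self hγ, mul_one, add_im,
    ← ofReal_intCast, im_ofReal_mul, ofReal_im, add_zero] at him
  field_simp
  linear_combination him

end IsWedgeFrame

section WedgeFrame

variable {a b : Lattice3} {γ α β δ₀ : DualLattice3}

lemma IsPrimitive.neg {M : Type*} [AddCommGroup M] {v : M} (hv : IsPrimitive v) :
    IsPrimitive (-v) := by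
  rintro k ⟨u, hu⟩
  exact hv k ⟨-u, by rw [smul_neg, ← hu, neg_neg]⟩

lemma IsPrimitive.ne_zero {M : Type*} [AddCommGroup M] {v : M} (hv : IsPrimitive v) : v ≠ 0 := by
  rintro rfl
  simpa using hv 0 ⟨0, by simp⟩

lemma IsPrimitive.isCoprime_of_eq_add {M : Type*} [AddCommGroup M] {u v : M} {p q : ℤ}
    (h : IsPrimitive (p • u + q • v)) : IsCoprime p q := by
  rw [Int.isCoprime_iff_gcd_eq_one]
  obtain ⟨p', hp⟩ := Int.gcd_dvd_left p q
  obtain ⟨q', hq⟩ := Int.gcd_dvd_right p q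
  have := h (Int.gcd p q) ⟨p' • u + q' • v, by
    rw [smul_add, smul_smul, smul_smul, ← hp, ← hq]⟩
  omega

lemma exists_cross_eq_of_isPrimitive (h : α ⨯₃ β = a) (h₀ : pair δ₀ a = 1) (hγ : IsPrimitive γ)
    (hγa : pair γ a = 0) : ∃ α', α' ⨯₃ γ = a := by
  obtain ⟨p, q, rfl⟩ := exists_eq_zsmul_add_zsmul h h₀ hγa
  obtain ⟨s, t, hst⟩ := hγ.isCoprime_of_eq_add
  refine ⟨t • α - s • β, ?_⟩
  simp only [map_sub, map_add, map_smul, LinearMap.sub_apply, LinearMap.smul_apply, cross_self,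
    h, ← cross_anticomm α β]
  linear_combination (exp := 1) hst • a

lemma pair_eq_of_cross_eq (h : α ⨯₃ γ = a) (hγ : γ ≠ 0) {s : ℤ} (hab : a ⨯₃ b = s • γ)
    (hγb : pair γ b = 0) : pair α b = s := by
  have := cross_cross_eq_smul_sub_smul α γ b
  rw [h, hab, ← pair_eq_dotProduct, ← pair_eq_dotProduct, hγb, zero_smul, sub_zero] at this
  exact (smul_left_injective ℤ hγ this).symm

lemma cross_eq_detForm (a b : Lattice3) : a ⨯₃ b = detForm a b := by
  ext i
  fin_cases i <;> simp [cross_apply, detForm, Matrix.det_fin_three]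
  ring

lemma pair_directionVector_eq_zero (hab : LinearIndependent ℤ ![a, b]) {c : Lattice3}
    (hc : c ⬝ᵥ a ⨯₃ b = 0) : pair (directionVector a b) c = 0 := by
  have hs : (modulus a b : ℤ) ≠ 0 := by exact_mod_cast (modulus_pos hab).ne'
  refine (mul_eq_zero.mp ?_).resolve_left hs
  rw [← (directionVector_spec hab).2.2, ← detForm_pair, ← cross_eq_detForm, pair_eq_dotProduct,
    dotProduct_comm, hc]

lemma Framing.cross_basis (f : Framing) (a : {a : Lattice3 // IsPrimitive a}) :
    f.basis a 1 ⨯₃ f.basis a 2 = (a : Lattice3) :=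
  cross_eq_of_basis (f.basis a) (f.oriented a) (f.pair_one a) (f.pair_two a) (f.pair_three a)

lemma exists_isWedgeFrame (f : Framing) (a b : {a : Lattice3 // IsPrimitive a})
    (hab : LinearIndependent ℤ ![(a : Lattice3), (b : Lattice3)]) :
    ∃ α β, IsWedgeFrame (a : Lattice3) b (directionVector a b) α β := by
  obtain ⟨hγ, hs, -⟩ := directionVector_spec hab
  have hγa := pair_directionVector_eq_zero hab (dot_self_cross _ _)
  have hγb := pair_directionVector_eq_zero hab (dot_cross_self _ _)
  have hcross : (a : Lattice3) ⨯₃ b = (modulus a b : ℤ) • directionVector a b := by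
    rw [cross_eq_detForm, modulus_smul]
  obtain ⟨α, hα⟩ := exists_cross_eq_of_isPrimitive (f.cross_basis a) (f.pair_one a) hγ hγa
  obtain ⟨β, hβ⟩ := exists_cross_eq_of_isPrimitive (f.cross_basis b) (f.pair_one b) hγ.neg
    (by rw [pair_neg, hγb, neg_zero])
  have hpos : 0 < pair α b := by
    rw [pair_eq_of_cross_eq hα hγ.ne_zero hcross hγb]
    exact_mod_cast hs
  exact ⟨α, β, hα, hβ, hpos, ⟨_, f.pair_one a⟩, ⟨_, f.pair_one b⟩⟩

end WedgeFrame

/-! ### Products over cones -/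

namespace IsWedgeFrame

variable {a b : Lattice3} {γ α β δ ε : DualLattice3}

lemma exists_pair_right_eq (h : IsWedgeFrame a b γ α β) (hε : pair ε a = pair δ a) :
    ∃ p : ℤ, pair ε b = pair δ b + p * pair α b := by
  obtain ⟨p, q, rfl⟩ := h.exists_eq_add_of_pair_left_eq hε
  refine ⟨p, ?_⟩
  rw [pair_add, pair_add, pair_zsmul, pair_zsmul, h.pair_dir_right, mul_zero, add_zero]

lemma exists_row_start (h : IsWedgeFrame a b γ α β) (m n : ℤ) :
    ∃ δ, pair δ a = m ∧ pair δ b ≤ n ∧ n < pair δ b + pair α b := by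
  obtain ⟨δ₀, hδ₀⟩ := h.unit_left
  set k := (n - m * pair δ₀ b) / pair α b
  have hle : k * pair α b ≤ n - m * pair δ₀ b := Int.ediv_mul_le _ h.pair_pos.ne'
  have hlt : n - m * pair δ₀ b < (k + 1) * pair α b := Int.lt_ediv_add_one_mul_self _ h.pair_pos
  refine ⟨m • δ₀ + k • α, ?_, ?_, ?_⟩
  · rw [pair_add, pair_zsmul, pair_zsmul, hδ₀, pair_left h.cross_left, mul_one, mul_zero, add_zero]
  · rw [pair_add, pair_zsmul, pair_zsmul]
    linarith
  · rw [pair_add, pair_zsmul, pair_zsmul]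
    linarith

lemma pair_right_le_iff (h : IsWedgeFrame a b γ α β) {n : ℤ} (hle : pair δ b ≤ n)
    (hlt : n < pair δ b + pair α b) :
    pair ε a = pair δ a ∧ pair ε b ≤ n ↔
      ∃ j : ℕ, pair ε a = pair (δ - (j : ℤ) • α) a ∧ pair ε b = pair (δ - (j : ℤ) • α) b := by
  simp only [pair_sub, pair_zsmul, pair_left h.cross_left, mul_zero, sub_zero, exists_and_left]
  refine and_congr_right fun hε => ⟨fun hn => ?_, ?_⟩
  · obtain ⟨p, hp⟩ := h.exists_pair_right_eq hε
    have hp0 : p ≤ 0 := by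
      by_contra! hp0
      have := le_mul_of_one_le_left h.pair_pos.le hp0
      omega
    refine ⟨(-p).toNat, ?_⟩
    rw [Int.toNat_of_nonneg (by omega), hp]
    ring
  · rintro ⟨j, hj⟩
    have := mul_nonneg (Int.natCast_nonneg j) h.pair_pos.le
    omega

lemma lt_pair_right_iff (h : IsWedgeFrame a b γ α β) {n : ℤ} (hle : pair δ b ≤ n)
    (hlt : n < pair δ b + pair α b) :
    pair ε a = pair δ a ∧ n < pair ε b ↔ ∃ j : ℕ, pair ε a = pair (δ + (j + 1 : ℤ) • α) a ∧
      pair ε b = pair (δ + (j + 1 : ℤ) • α) b := by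
  simp only [pair_add, pair_zsmul, pair_left h.cross_left, mul_zero, add_zero, exists_and_left]
  refine and_congr_right fun hε => ⟨fun hn => ?_, ?_⟩
  · obtain ⟨p, hp⟩ := h.exists_pair_right_eq hε
    have hp0 : 0 < p := by
      by_contra! hp0
      have := mul_nonpos_of_nonpos_of_nonneg hp0 h.pair_pos.le
      omega
    refine ⟨(p - 1).toNat, ?_⟩
    rw [Int.toNat_of_nonneg (by omega), hp]
    ring
  · rintro ⟨j, hj⟩
    have := le_mul_of_one_le_left (a := (j + 1 : ℤ)) h.pair_pos.le (by omega)
    omega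

end IsWedgeFrame

/-- The exponential `e^{-2πi(δ(x) - w)/γ(x)}` in the factors of the gamma function of a wedge. -/
def coneTerm (γ δ : DualLattice3) (w : ℂ) (x : Fin 3 → ℂ) : ℂ :=
  exp (-(2 * Real.pi * I * ((ev δ x - w) / ev γ x)))

/-- `D` chooses one form `δ` for each possible pair of values `(δ(a), δ(b))`. -/
def IsSection {ι : Type*} (a b : Lattice3) (D : ι → DualLattice3) : Prop :=
  ∀ δ, ∃! i, pair (D i) a = pair δ a ∧ pair (D i) b = pair δ b

section Cone

variable {ι : Type*} {a b : Lattice3} {γ α β : DualLattice3} {D : ι → DualLattice3}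
  {x : Fin 3 → ℂ}

/-- The cone `δ(a) > -M`, `δ(b) ≤ -N`, as a set of indices of the family `D`. -/
def coneSet (a b : Lattice3) (D : ι → DualLattice3) (M N : ℤ) : Set ι :=
  {i | -M < pair (D i) a ∧ pair (D i) b ≤ -N}

/-- The half `δ(b) ≤ -N` of the row `δ(a) = -M`, as a set of indices of the family `D`. -/
def lowerRow (a b : Lattice3) (D : ι → DualLattice3) (M N : ℤ) : Set ι :=
  {i | pair (D i) a = -M ∧ pair (D i) b ≤ -N}

/-- The half `δ(b) > -N` of the row `δ(a) = -M`, as a set of indices of the family `D`. -/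
def upperRow (a b : Lattice3) (D : ι → DualLattice3) (M N : ℤ) : Set ι :=
  {i | pair (D i) a = -M ∧ -N < pair (D i) b}

/-- The product of the factors `1 - e^{-2πi(δ(x) - w)/γ(x)}` over a set of indices of `D`. -/
def coneProd (γ : DualLattice3) (D : ι → DualLattice3) (S : Set ι) (w : ℂ)
    (x : Fin 3 → ℂ) : ℂ :=
  ∏' i : S, (1 - coneTerm γ (D i) w x)

/-- The product over the row `δ(a) = -M`, with `γ` replaced by `-γ` in its upper half. -/
def rowProd (a b : Lattice3) (γ : DualLattice3) (D : ι → DualLattice3) (M N : ℤ) (w : ℂ)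
    (x : Fin 3 → ℂ) : ℂ :=
  coneProd γ D (lowerRow a b D M N) w x * coneProd (-γ) D (upperRow a b D M N) w x

/-- The gamma function of the wedge `(a, b)` with the boundaries of its cones moved from
`δ(a) = 0`, `δ(b) = 0` to `δ(a) = -M`, `δ(b) = -N`. -/
def coneRatio (a b : Lattice3) (γ : DualLattice3) (D : ι → DualLattice3) (M N : ℤ) (w : ℂ)
    (x : Fin 3 → ℂ) : ℂ :=
  coneProd γ D (coneSet a b D M N) w x / coneProd (-γ) D (coneSet b a D N M) w x

lemma IsSection.swap (h : IsSection a b D) : IsSection b a D := fun δ => by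
  simpa only [and_comm] using h δ

lemma IsSection.eq_of_pair_eq (hD : IsSection a b D) {i j : ι} (h : pair (D i) a = pair (D j) a)
    (h' : pair (D i) b = pair (D j) b) : i = j :=
  (hD (D j)).unique ⟨h, h'⟩ ⟨rfl, rfl⟩

lemma IsSection.tprod_eq {κ : Type*} (hD : IsSection a b D) {f : DualLattice3 → ℂ}
    (hf : ∀ δ ε, pair δ a = pair ε a → pair δ b = pair ε b → f δ = f ε) {S : Set ι}
    {ε : κ → DualLattice3} (hε : Function.Injective fun j => (pair (ε j) a, pair (ε j) b))
    (hS : ∀ i, i ∈ S ↔ ∃ j, pair (D i) a = pair (ε j) a ∧ pair (D i) b = pair (ε j) b) :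
    ∏' i : S, f (D i) = ∏' j, f (ε j) := by
  choose idx hidx using fun j => (hD (ε j)).exists
  let e : κ → S := fun j => ⟨idx j, (hS _).mpr ⟨j, hidx j⟩⟩
  have he : Function.Bijective e := by
    constructor
    · intro j k hjk
      have : idx j = idx k := congrArg Subtype.val hjk
      refine hε (Prod.ext ((hidx j).1.symm.trans (this ▸ (hidx k).1))
        ((hidx j).2.symm.trans (this ▸ (hidx k).2)))
    · rintro ⟨i, hi⟩
      obtain ⟨j, hj⟩ := (hS i).mp hi
      exact ⟨j, Subtype.ext (hD.eq_of_pair_eq ((hidx j).1.trans hj.1.symm)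
        ((hidx j).2.trans hj.2.symm))⟩
  rw [← (Equiv.ofBijective e he).tprod_eq]
  exact tprod_congr fun j => hf _ _ (hidx j).1 (hidx j).2

lemma coneTerm_congr (h : IsWedgeFrame a b γ α β) {δ ε : DualLattice3}
    (hδ : pair δ a = pair ε a) (hδ' : pair δ b = pair ε b) (w : ℂ) (x : Fin 3 → ℂ) :
    coneTerm γ δ w x = coneTerm γ ε w x := by
  obtain ⟨q, rfl⟩ := h.exists_eq_add_of_pair_eq hδ hδ'
  have := exp_shift (-1) q (ev ε x - w) (ev γ x)
  rw [coneTerm, coneTerm, ev_add, ev_zsmul, add_sub_right_comm]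
  simpa using this

lemma norm_coneTerm (γ δ : DualLattice3) (w : ℂ) (x : Fin 3 → ℂ) :
    ‖coneTerm γ δ w x‖ = Real.exp (2 * Real.pi * ((ev δ x - w) / ev γ x).im) := by
  rw [coneTerm, Complex.norm_exp]
  simp

lemma summable_exp_neg_mul_exp_neg {p q : ℝ} (hp : 0 < p) (hq : 0 < q) :
    Summable fun k : ℕ × ℕ => Real.exp (k.1 * -p) * Real.exp (k.2 * -q) :=
  (Real.summable_exp_nat_mul_iff.mpr (neg_neg_of_pos hp)).mul_of_nonneg
    (Real.summable_exp_nat_mul_iff.mpr (neg_neg_of_pos hq)) (fun _ => (Real.exp_pos _).le)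
    fun _ => (Real.exp_pos _).le

lemma summable_norm_coneTerm (h : IsWedgeFrame a b γ α β) (ha : 0 < orientedVolume a x)
    (hb : 0 < orientedVolume b x) (hD : IsSection a b D) (M N : ℤ) (w : ℂ) :
    Summable fun i : coneSet a b D M N => ‖coneTerm γ (D i) w x‖ := by
  obtain ⟨p, q, hp, hq, him⟩ := h.exists_im_ev_div_eq ha hb
  let e : coneSet a b D M N → ℕ × ℕ := fun i =>
    ((pair (D i) a + M).toNat, (-N - pair (D i) b).toNat)
  have he : Function.Injective e := by
    rintro ⟨i, hi, hi'⟩ ⟨j, hj, hj'⟩ hij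
    simp only [e, Prod.mk.injEq] at hij
    obtain rfl : i = j := hD.eq_of_pair_eq (by omega) (by omega)
    rfl
  have hsum := summable_exp_neg_mul_exp_neg (mul_pos Real.two_pi_pos hp)
    (mul_pos Real.two_pi_pos hq)
  refine ((hsum.comp_injective he).mul_left
    (Real.exp (2 * Real.pi * (p * M - q * N - (w / ev γ x).im)))).congr ?_
  rintro ⟨i, hi, hi'⟩
  have hcast₁ : ((pair (D i) a + M).toNat : ℝ) = pair (D i) a + M := by
    exact_mod_cast Int.toNat_of_nonneg (by omega)
  have hcast₂ : ((-N - pair (D i) b).toNat : ℝ) = -N - pair (D i) b := by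
    exact_mod_cast Int.toNat_of_nonneg (by omega)
  simp only [Function.comp_apply, e]
  rw [norm_coneTerm, sub_div, sub_im, him, ← Real.exp_add, ← Real.exp_add, hcast₁, hcast₂]
  ring_nf

lemma coneProd_union (h : IsWedgeFrame a b γ α β) (ha : 0 < orientedVolume a x)
    (hb : 0 < orientedVolume b x) (hD : IsSection a b D) {M N : ℤ} {S T : Set ι}
    (hS : S ⊆ coneSet a b D M N) (hT : T ⊆ coneSet a b D M N) (hST : Disjoint S T) (w : ℂ) :
    coneProd γ D (S ∪ T) w x = coneProd γ D S w x * coneProd γ D T w x := by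
  have hmult {S : Set ι} (hS : S ⊆ coneSet a b D M N) :
      Multipliable fun i : S => 1 - coneTerm γ (D i) w x := by
    have := (summable_norm_coneTerm h ha hb hD M N w).comp_injective (Set.inclusion_injective hS)
    exact multipliable_one_sub this
  exact Multipliable.tprod_union_disjoint (f := fun i => 1 - coneTerm γ (D i) w x) hST
    (hmult hS) (hmult hT)

lemma coneProd_succ_left (h : IsWedgeFrame a b γ α β) (ha : 0 < orientedVolume a x)
    (hb : 0 < orientedVolume b x) (hD : IsSection a b D) (M N : ℤ) (w : ℂ) :
    coneProd γ D (coneSet a b D (M + 1) N) w x =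
      coneProd γ D (coneSet a b D M N) w x * coneProd γ D (lowerRow a b D M N) w x := by
  have hunion : coneSet a b D (M + 1) N = coneSet a b D M N ∪ lowerRow a b D M N := by
    ext i
    simp only [coneSet, lowerRow, Set.mem_union, Set.mem_ofPred_eq]
    omega
  rw [hunion]
  refine coneProd_union h ha hb hD (hunion ▸ Set.subset_union_left)
    (hunion ▸ Set.subset_union_right) (Set.disjoint_left.mpr ?_) w
  rintro i ⟨hi, -⟩ ⟨hi', -⟩
  omega

lemma coneProd_swap_eq_mul_upperRow (h : IsWedgeFrame a b γ α β) (ha : 0 < orientedVolume a x)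
    (hb : 0 < orientedVolume b x) (hD : IsSection a b D) (M N : ℤ) (w : ℂ) :
    coneProd (-γ) D (coneSet b a D N M) w x =
      coneProd (-γ) D (coneSet b a D N (M + 1)) w x *
        coneProd (-γ) D (upperRow a b D M N) w x := by
  have hunion : coneSet b a D N M = coneSet b a D N (M + 1) ∪ upperRow a b D M N := by
    ext i
    simp only [coneSet, upperRow, Set.mem_union, Set.mem_ofPred_eq]
    omega
  rw [hunion]
  refine coneProd_union h.swap hb ha hD.swap (hunion ▸ Set.subset_union_left)
    (hunion ▸ Set.subset_union_right) (Set.disjoint_left.mpr ?_) w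
  rintro i ⟨-, hi⟩ ⟨hi', -⟩
  omega

lemma coneTerm_add_ev (γ δ μ : DualLattice3) (w : ℂ) (x : Fin 3 → ℂ) :
    coneTerm γ δ (w + ev μ x) x = coneTerm γ (δ - μ) w x := by
  rw [coneTerm, coneTerm, ev_sub, sub_sub, add_comm w]

lemma coneProd_add_ev (h : IsWedgeFrame a b γ α β) (hD : IsSection a b D) (μ : DualLattice3)
    (w : ℂ) (x : Fin 3 → ℂ) : coneProd γ D (coneSet a b D 0 0) (w + ev μ x) x =
      coneProd γ D (coneSet a b D (pair μ a) (pair μ b)) w x := by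
  simp only [coneProd, coneTerm_add_ev]
  refine (hD.tprod_eq (f := fun δ => 1 - coneTerm γ δ w x)
    (ε := fun j : coneSet a b D 0 0 => D j - μ)
    (fun δ ε h₁ h₂ => congrArg _ (coneTerm_congr h h₁ h₂ w x)) (fun j k hjk => ?_) fun i => ?_).symm
  · simp only [pair_sub, Prod.mk.injEq, sub_left_inj] at hjk
    exact Subtype.ext (hD.eq_of_pair_eq hjk.1 hjk.2)
  · obtain ⟨j, hja, hjb⟩ := (hD (D i + μ)).exists
    rw [pair_add] at hja hjb
    simp only [coneSet, Set.mem_ofPred_eq, Subtype.exists, pair_sub]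
    refine ⟨fun hi => ⟨j, by omega, by omega⟩, ?_⟩
    rintro ⟨k, hk, hk'⟩
    omega

lemma coneRatio_add_ev (h : IsWedgeFrame a b γ α β) (hD : IsSection a b D) (μ : DualLattice3)
    (w : ℂ) (x : Fin 3 → ℂ) : coneRatio a b γ D 0 0 (w + ev μ x) x =
      coneRatio a b γ D (pair μ a) (pair μ b) w x := by
  rw [coneRatio, coneRatio, coneProd_add_ev h hD, coneProd_add_ev h.swap hD.swap]

lemma rowProd_eq_planeTheta (h : IsWedgeFrame a b γ α β) (ha : 0 < orientedVolume a x)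
    (hD : IsSection a b D) {M N : ℤ} {δ : DualLattice3}
    (hδ : pair δ a = -M) (hle : pair δ b ≤ -N) (hlt : -N < pair δ b + pair α b) (w : ℂ) :
    rowProd a b γ D M N w x = planeTheta α γ x (w - ev δ x) := by
  have hγ := ev_right_ne_zero h.cross_left ha
  have hlower : coneProd γ D (lowerRow a b D M N) w x =
      ∏' j : ℕ, (1 - coneTerm γ (δ - (j : ℤ) • α) w x) := by
    refine hD.tprod_eq (f := fun δ => 1 - coneTerm γ δ w x)
      (fun δ ε h₁ h₂ => congrArg _ (coneTerm_congr h h₁ h₂ w x)) (fun j k hjk => ?_) fun i => ?_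
    · simp only [pair_sub, pair_zsmul, Prod.mk.injEq] at hjk
      simpa [h.pair_pos.ne'] using hjk.2
    · rw [← h.pair_right_le_iff hle hlt, hδ, lowerRow, Set.mem_ofPred_eq]
  have hupper : coneProd (-γ) D (upperRow a b D M N) w x =
      ∏' j : ℕ, (1 - coneTerm (-γ) (δ + (j + 1 : ℤ) • α) w x) := by
    refine hD.tprod_eq (f := fun δ => 1 - coneTerm (-γ) δ w x)
      (fun δ ε h₁ h₂ => congrArg _ (coneTerm_congr h.swap h₂ h₁ w x)) (fun j k hjk => ?_)
      fun i => ?_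
    · simp only [pair_add, pair_zsmul, Prod.mk.injEq] at hjk
      simpa [h.pair_pos.ne'] using hjk.2
    · rw [← h.lt_pair_right_iff hle hlt, hδ, upperRow, Set.mem_ofPred_eq]
  rw [rowProd, hlower, hupper, planeTheta, theta0_eq_mul (im_ev_div_pos h.cross_left ha), mul_comm]
  congr 1 <;> refine tprod_congr fun j => ?_
  · rw [coneTerm, ev_add, ev_zsmul, ev_neg]
    congr 2
    push_cast
    field_simp
    ring
  · rw [coneTerm, ev_sub, ev_zsmul]
    congr 2
    push_cast
    field_simp
    ring

lemma coneRatio_swap (a b : Lattice3) (γ : DualLattice3) (D : ι → DualLattice3) (M N : ℤ) (w : ℂ)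
    (x : Fin 3 → ℂ) : coneRatio b a (-γ) D N M w x = (coneRatio a b γ D M N w x)⁻¹ := by
  rw [coneRatio, coneRatio, neg_neg, inv_div]

lemma coneRatio_succ_left (h : IsWedgeFrame a b γ α β) (ha : 0 < orientedVolume a x)
    (hb : 0 < orientedVolume b x) (hD : IsSection a b D) {M N : ℤ} {w : ℂ}
    (hrow : rowProd a b γ D M N w x ≠ 0) :
    coneRatio a b γ D (M + 1) N w x = rowProd a b γ D M N w x * coneRatio a b γ D M N w x := by
  have hupper := right_ne_zero_of_mul hrow
  rw [coneRatio, coneRatio, coneProd_succ_left h ha hb hD,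
    coneProd_swap_eq_mul_upperRow h ha hb hD M, rowProd, ← mul_div_mul_right _ _ hupper,
    mul_div_assoc']
  ring_nf

end Cone

/-! ### Telescoping -/

/-- The product of `g k` over `0 ≤ k < M`, which for `M < 0` means the inverse of the product over
`M ≤ k < 0`. -/
def intervalProd {K : Type*} [DivisionCommMonoid K] (g : ℤ → K) (M : ℤ) : K :=
  (∏ k ∈ Finset.Ico 0 M, g k) / ∏ k ∈ Finset.Ico M 0, g k

lemma mul_prod_Ico_eq_of_succ_eq {K : Type*} [CommRing K] {r g : ℤ → K} {M : ℤ}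
    (hr : ∀ k ∈ Finset.Ico 0 M ∪ Finset.Ico M 0, r (k + 1) = g k * r k) :
    r M * ∏ k ∈ Finset.Ico M 0, g k = (∏ k ∈ Finset.Ico 0 M, g k) * r 0 := by
  simp only [Finset.mem_union, Finset.mem_Ico] at hr
  induction M using Int.induction_on with
  | zero => simp
  | succ n ih =>
    have hn := ih fun k hk => hr k (by omega)
    rw [Finset.Ico_eq_empty (by omega), Finset.prod_empty, mul_one] at hn ⊢
    rw [← Finset.insert_Ico_right_eq_Ico_add_one (by omega), Finset.prod_insert (by simp),
      hr n (by omega), hn, mul_assoc]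
  | pred n ih =>
    have hn := ih fun k hk => hr k (by omega)
    rw [Finset.Ico_eq_empty (a := 0) (by omega), Finset.prod_empty, one_mul] at hn ⊢
    have hstep := hr (-n - 1) (by omega)
    rw [sub_add_cancel] at hstep
    rw [← Finset.insert_Ico_add_one_left_eq_Ico (by omega), sub_add_cancel,
      Finset.prod_insert (by simp), ← hn, hstep]
    ring

lemma eq_intervalProd_mul_of_succ_eq {K : Type*} [Field K] {r g : ℤ → K} {M : ℤ}
    (hr : ∀ k, g k ≠ 0 → r (k + 1) = g k * r k) (hg : intervalProd g M ≠ 0) :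
    r M = intervalProd g M * r 0 := by
  obtain ⟨hnum, hden⟩ := div_ne_zero_iff.mp hg
  rw [intervalProd, div_mul_eq_mul_div, eq_div_iff hden]
  rw [Finset.prod_ne_zero_iff] at hnum hden
  exact mul_prod_Ico_eq_of_succ_eq fun k hk =>
    hr k ((Finset.mem_union.mp hk).elim (hnum k) (hden k))

lemma ExpEquiv.intervalProd {U : Set (Fin 3 → ℂ)} {F G : ℤ → (Fin 3 → ℂ) → ℂ → ℂ}
    (h : ∀ k, ExpEquiv U (F k) (G k)) (M : ℤ) :
    ExpEquiv U (fun x w => GammaWedge.intervalProd (fun k => F k x w) M)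
      (fun x w => GammaWedge.intervalProd (fun k => G k x w) M) := by
  have := (prod (Finset.Ico 0 M) fun k _ => h k).div (prod (Finset.Ico M 0) fun k _ => h k)
  simpa only [ExpEquiv, GammaWedge.intervalProd, Pi.div_apply, Finset.prod_apply] using this

section Shift

variable {ι : Type*} {a b : Lattice3} {γ α β α₀ α' β' : DualLattice3} {D : ι → DualLattice3}
  {U : Set (Fin 3 → ℂ)}

lemma rowProd_equiv (h : IsWedgeFrame a b γ α β) (hD : IsSection a b D) (h₀ : pair α₀ a = 1)
    (h' : α' ⨯₃ β' = a) (hU : ∀ x ∈ U, 0 < orientedVolume a x) (M N : ℤ) :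
    ExpEquiv U (fun x w => rowProd a b γ D M N w x)
      (fun x w => planeTheta α' β' x (w + M * ev α₀ x)) := by
  obtain ⟨δ, hδ, hle, hlt⟩ := h.exists_row_start (-M) (-N)
  obtain ⟨φ, hφ, hθ⟩ := planeTheta_add_ev_equiv (δ := -δ) (ε := M • α₀) h₀ hU h.cross_left h' (by
    rw [pair_neg, pair_zsmul, hδ, h₀, neg_neg, mul_one])
  refine ⟨φ, hφ, fun x hx w => ?_⟩
  beta_reduce
  rw [rowProd_eq_planeTheta h (hU x hx) hD hδ hle hlt, sub_eq_add_neg, ← ev_neg, ← ev_zsmul]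
  exact hθ x hx w

lemma exists_coneRatio_eq (h : IsWedgeFrame a b γ α β) (hD : IsSection a b D)
    (h₀ : pair α₀ a = 1) (h' : α' ⨯₃ β' = a) (hUa : ∀ x ∈ U, 0 < orientedVolume a x)
    (hUb : ∀ x ∈ U, 0 < orientedVolume b x) (M N : ℤ) :
    ∃ φ ∈ exponents U, ∀ x ∈ U, ∀ w,
      intervalProd (fun k : ℤ => planeTheta α' β' x (w + k * ev α₀ x)) M ≠ 0 →
      coneRatio a b γ D M N w x = exp (Real.pi * I * φ x w) *
        intervalProd (fun k : ℤ => planeTheta α' β' x (w + k * ev α₀ x)) M *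
          coneRatio a b γ D 0 N w x := by
  obtain ⟨φ, hφ, hrows⟩ := ExpEquiv.intervalProd (fun k => rowProd_equiv h hD h₀ h' hUa k N) M
  refine ⟨φ, hφ, fun x hx w hne => ?_⟩
  have hrow := hrows x hx w
  beta_reduce at hrow
  rw [← hrow]
  refine eq_intervalProd_mul_of_succ_eq (r := fun k => coneRatio a b γ D k N w x)
    (fun k => coneRatio_succ_left h (hUa x hx) (hUb x hx) hD) ?_
  rw [hrow]
  exact mul_ne_zero (Complex.exp_ne_zero _) hne

end Shift

/-! ### Nonvanishing off a discrete set -/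

section Nonvanishing

open Filter Topology

lemma eventually_nhdsNE_exp_mul_ne_one {c : ℂ} (hc : c ≠ 0) (v w₀ : ℂ) :
    ∀ᶠ w in 𝓝[≠] w₀, exp (c * w) * v ≠ 1 := by
  rcases eq_or_ne v 0 with rfl | hv
  · simp
  · have hderiv : HasDerivAt (fun w => exp (c * w) * v) (exp (c * w₀) * (c * 1) * v) w₀ :=
      (((hasDerivAt_id w₀).const_mul c).cexp).mul_const v
    exact hderiv.eventually_ne
      (mul_ne_zero (mul_ne_zero (Complex.exp_ne_zero _) (by simpa using hc)) hv)

lemma eventually_codiscrete_forall_exp_mul_ne_one {ι : Type*} {v : ι → ℂ}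
    (hv : Tendsto (‖v ·‖) cofinite (𝓝 0)) {c : ℂ} (hc : c ≠ 0) :
    ∀ᶠ w in codiscrete ℂ, ∀ i, exp (c * w) * v i ≠ 1 := by
  rw [Filter.Eventually, mem_codiscrete]
  intro w₀
  rw [disjoint_principal_right, compl_compl]
  set B : ℝ := ‖exp (c * w₀)‖ + 1
  have hcont : Tendsto (fun w => ‖exp (c * w)‖) (𝓝[≠] w₀) (𝓝 ‖exp (c * w₀)‖) :=
    ((by fun_prop : Continuous fun w => ‖exp (c * w)‖).tendsto w₀).mono_left nhdsWithin_le_nhds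
  have hsmall : ∀ᶠ i in cofinite, B * ‖v i‖ < 1 :=
    (hv.const_mul B).eventually_lt_const (by simp)
  have hlarge : ∀ᶠ w in 𝓝[≠] w₀, ∀ i ∈ {i | ¬B * ‖v i‖ < 1}, exp (c * w) * v i ≠ 1 :=
    (eventually_all_finite (eventually_cofinite.mp hsmall)).mpr fun i _ =>
      eventually_nhdsNE_exp_mul_ne_one hc (v i) w₀
  filter_upwards [hlarge, hcont.eventually_lt_const (lt_add_one _)] with w hw hwB i
  by_cases hi : B * ‖v i‖ < 1
  · intro hone
    have hle := mul_le_mul_of_nonneg_right hwB.le (norm_nonneg (v i))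
    rw [← norm_mul, hone, norm_one] at hle
    exact hi.not_ge hle
  · exact hw i hi

lemma eventually_codiscrete_tprod_ne_zero {ι : Type*} {v : ι → ℂ} (hv : Summable (‖v ·‖)) {c : ℂ}
    (hc : c ≠ 0) : ∀ᶠ w in codiscrete ℂ, ∏' i, (1 - exp (c * w) * v i) ≠ 0 := by
  filter_upwards [eventually_codiscrete_forall_exp_mul_ne_one hv.tendsto_cofinite_zero hc] with w hw
  refine tprod_one_sub_ne_zero ?_ hw
  simpa only [norm_mul] using hv.mul_left ‖exp (c * w)‖

lemma eventually_codiscrete_theta0_ne_zero {τ : ℂ} (hτ : 0 < τ.im) (d : ℂ) {g : ℂ} (hg : g ≠ 0) :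
    ∀ᶠ w in codiscrete ℂ, theta0 ((w + d) / g) τ ≠ 0 := by
  have hc : 2 * Real.pi * I / g ≠ 0 := div_ne_zero Complex.two_pi_I_ne_zero hg
  filter_upwards [eventually_codiscrete_tprod_ne_zero (summable_norm_exp_mul_add hτ (d / g)) hc,
    eventually_codiscrete_tprod_ne_zero (summable_norm_exp_succ_mul_sub hτ (d / g))
      (neg_ne_zero.mpr hc)] with w hpos hneg
  rw [theta0_eq_mul hτ]
  refine mul_ne_zero ?_ ?_
  · convert hneg using 4 with j
    rw [← Complex.exp_add]
    congr 1
    field_simp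
    ring
  · convert hpos using 4 with j
    rw [← Complex.exp_add]
    congr 1
    field_simp
    ring

lemma eventually_codiscrete_intervalProd_ne_zero {g : ℤ → ℂ → ℂ}
    (hg : ∀ k, ∀ᶠ w in codiscrete ℂ, g k w ≠ 0) (M : ℤ) :
    ∀ᶠ w in codiscrete ℂ, intervalProd (fun k => g k w) M ≠ 0 := by
  filter_upwards [(eventually_all_finset (Finset.Ico 0 M)).mpr fun k _ => hg k,
    (eventually_all_finset (Finset.Ico M 0)).mpr fun k _ => hg k] with w hnum hden
  exact div_ne_zero (Finset.prod_ne_zero_iff.mpr hnum) (Finset.prod_ne_zero_iff.mpr hden)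

lemma eventually_codiscrete_Delta_ne_zero (f : Framing) (a : {a : Lattice3 // IsPrimitive a})
    (μ : DualLattice3) {x : Fin 3 → ℂ} (ha : 0 < orientedVolume a x) :
    ∀ᶠ w in codiscrete ℂ, Delta f a μ w x ≠ 0 :=
  eventually_codiscrete_intervalProd_ne_zero
    (fun _ => eventually_codiscrete_theta0_ne_zero (im_ev_div_pos (f.cross_basis a) ha) _
      (ev_right_ne_zero (f.cross_basis a) ha)) _

variable {ι : Type*} {a b : Lattice3} {γ α β : DualLattice3} {D : ι → DualLattice3}
  {x : Fin 3 → ℂ}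

lemma eventually_codiscrete_coneProd_ne_zero (h : IsWedgeFrame a b γ α β)
    (ha : 0 < orientedVolume a x) (hb : 0 < orientedVolume b x) (hD : IsSection a b D) (M N : ℤ) :
    ∀ᶠ w in codiscrete ℂ, coneProd γ D (coneSet a b D M N) w x ≠ 0 := by
  have hγ := ev_right_ne_zero h.cross_left ha
  filter_upwards [eventually_codiscrete_tprod_ne_zero (summable_norm_coneTerm h ha hb hD M N 0)
    (div_ne_zero Complex.two_pi_I_ne_zero hγ)] with w hw
  rw [coneProd]
  convert hw using 4 with i
  rw [coneTerm, coneTerm, ← Complex.exp_add]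
  congr 1
  field_simp
  ring

lemma eventually_codiscrete_coneRatio_ne_zero (h : IsWedgeFrame a b γ α β)
    (ha : 0 < orientedVolume a x) (hb : 0 < orientedVolume b x) (hD : IsSection a b D) (M N : ℤ) :
    ∀ᶠ w in codiscrete ℂ, coneRatio a b γ D M N w x ≠ 0 := by
  filter_upwards [eventually_codiscrete_coneProd_ne_zero h ha hb hD M N,
    eventually_codiscrete_coneProd_ne_zero h.swap hb ha hD.swap N M] with w hnum hden
  exact div_ne_zero hnum hden

end Nonvanishing

/-! ### The gamma function of a wedge -/

/-- A representative in `Λ^∨` of each class modulo `ℤγ`. -/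
def representative (γ : DualLattice3) (q : DualLattice3 ⧸ AddSubgroup.zmultiples γ) :
    DualLattice3 :=
  Quotient.out q

section GammaFun

variable {a b : Lattice3} {γ α β : DualLattice3}

lemma mk_representative (q : DualLattice3 ⧸ AddSubgroup.zmultiples γ) :
    (representative γ q : DualLattice3 ⧸ AddSubgroup.zmultiples γ) = q :=
  Quotient.out_eq q

lemma pair_representative (ha : pair γ a = 0) (δ : DualLattice3) :
    pair (representative γ (δ : DualLattice3 ⧸ AddSubgroup.zmultiples γ)) a = pair δ a := by
  obtain ⟨n, hn⟩ := AddSubgroup.mem_zmultiples_iff.mp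
    (QuotientAddGroup.eq.mp (mk_representative (δ : DualLattice3 ⧸ AddSubgroup.zmultiples γ)).symm)
  rw [← sub_eq_zero, ← pair_sub, ← neg_add_eq_sub, ← hn, pair_zsmul, ha, mul_zero]

lemma IsWedgeFrame.isSection (h : IsWedgeFrame a b γ α β) : IsSection a b (representative γ) := by
  refine fun δ => ⟨δ, ⟨pair_representative h.pair_dir_left δ,
    pair_representative h.pair_dir_right δ⟩, fun q hq => ?_⟩
  obtain ⟨n, hn⟩ := h.exists_eq_add_of_pair_eq hq.1 hq.2
  rw [← mk_representative q, hn, QuotientAddGroup.mk_add_of_mem]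
  exact AddSubgroup.zsmul_mem_zmultiples γ n

lemma image_mk_eq_coneSet (ha : pair γ a = 0) (hb : pair γ b = 0) :
    (fun δ : DualLattice3 => (δ : DualLattice3 ⧸ AddSubgroup.zmultiples γ)) ''
      (posHalf a ∩ negHalf b) = coneSet a b (representative γ) 0 0 := by
  ext q
  constructor
  · rintro ⟨δ, hδ, rfl⟩
    simpa [posHalf, negHalf, coneSet, pair_representative ha, pair_representative hb] using hδ
  · intro hq
    exact ⟨representative γ q, by simpa [posHalf, negHalf, coneSet] using hq, mk_representative q⟩

lemma wedgeFactor_neg_one (w : ℂ) (x : Fin 3 → ℂ)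
    (q : DualLattice3 ⧸ AddSubgroup.zmultiples γ) :
    wedgeFactor (-1) γ w x q = 1 - coneTerm γ (representative γ q) w x := by
  conv_lhs => rw [← mk_representative q]
  change 1 - exp _ = 1 - exp _
  simp

lemma wedgeFactor_one (w : ℂ) (x : Fin 3 → ℂ) (q : DualLattice3 ⧸ AddSubgroup.zmultiples γ) :
    wedgeFactor 1 γ w x q = 1 - coneTerm (-γ) (representative γ q) w x := by
  conv_lhs => rw [← mk_representative q]
  change 1 - exp _ = 1 - exp _
  simp [ev_neg, div_neg]

lemma gammaFun_eq_coneRatio (h : IsWedgeFrame a b (directionVector a b) α β) (w : ℂ)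
    (x : Fin 3 → ℂ) : gammaFun a b w x =
      coneRatio a b (directionVector a b) (representative (directionVector a b)) 0 0 w x := by
  rw [gammaFun, Set.inter_comm (negHalf a), image_mk_eq_coneSet h.pair_dir_left h.pair_dir_right,
    image_mk_eq_coneSet h.pair_dir_right h.pair_dir_left]
  simp only [wedgeFactor_neg_one, wedgeFactor_one]
  rfl

lemma gammaFun_add_ev (h : IsWedgeFrame a b (directionVector a b) α β) (μ : DualLattice3) (w : ℂ)
    (x : Fin 3 → ℂ) : gammaFun a b (w + ev μ x) x = coneRatio a b (directionVector a b)
      (representative (directionVector a b)) (pair μ a) (pair μ b) w x := by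
  rw [gammaFun_eq_coneRatio h, coneRatio_add_ev h h.isSection]

end GammaFun

section Framing

variable (f : Framing) {a b : {a : Lattice3 // IsPrimitive a}}

lemma exists_coneRatio_eq_Delta {ι : Type*} {γ α β : DualLattice3} {D : ι → DualLattice3}
    (h : IsWedgeFrame (a : Lattice3) b γ α β) (hD : IsSection (a : Lattice3) b D)
    (μ : DualLattice3) (N : ℤ) :
    ∃ φ ∈ exponents (domain a ∩ domain b), ∀ x ∈ domain a ∩ domain b, ∀ w, Delta f a μ w x ≠ 0 →
      coneRatio a b γ D (pair μ a) N w x =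
        exp (Real.pi * I * φ x w) * Delta f a μ w x * coneRatio a b γ D 0 N w x :=
  exists_coneRatio_eq h hD (f.pair_one a) (f.cross_basis a)
    (fun _ hx => orientedVolume_pos a.2.ne_zero hx.1)
    (fun _ hx => orientedVolume_pos b.2.ne_zero hx.2) (pair μ a) N

lemma exists_gammaFun_div_eq (hab : LinearIndependent ℤ ![(a : Lattice3), (b : Lattice3)])
    (μ : DualLattice3) :
    ∃ φ ∈ exponents (domain a ∩ domain b), ∀ x ∈ domain a ∩ domain b, ∀ w,
      gammaFun a b w x ≠ 0 → Delta f a μ w x ≠ 0 → Delta f b μ w x ≠ 0 →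
      gammaFun a b (w + ev μ x) x / gammaFun a b w x =
        exp (Real.pi * I * φ x w) * (Delta f a μ w x / Delta f b μ w x) := by
  obtain ⟨α, β, h⟩ := exists_isWedgeFrame f a b hab
  obtain ⟨φ, hφ, hleft⟩ := exists_coneRatio_eq_Delta f h h.isSection μ 0
  obtain ⟨ψ, hψ, hright⟩ := exists_coneRatio_eq_Delta f h.swap h.isSection.swap μ (pair μ a)
  rw [Set.inter_comm] at hψ
  refine ⟨_, sub_mem hφ hψ, fun x hx w hΓ ha hb => ?_⟩
  have hright := congrArg (·⁻¹) (hright x hx.symm w hb)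
  simp only [coneRatio_swap, mul_inv, inv_inv] at hright
  rw [gammaFun_add_ev h, hright, hleft x hx w ha, ← gammaFun_eq_coneRatio h, Pi.sub_apply,
    Pi.sub_apply, mul_sub, Complex.exp_sub]
  field_simp

lemma eventually_codiscrete_gammaFun_Delta_ne_zero
    (hab : LinearIndependent ℤ ![(a : Lattice3), (b : Lattice3)]) (μ : DualLattice3)
    {x : Fin 3 → ℂ} (hx : x ∈ domain a ∩ domain b) :
    ∀ᶠ w in Filter.codiscrete ℂ, gammaFun a b w x ≠ 0 ∧ gammaFun a b (w + ev μ x) x ≠ 0 ∧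
      Delta f a μ w x ≠ 0 ∧ Delta f b μ w x ≠ 0 := by
  obtain ⟨α, β, h⟩ := exists_isWedgeFrame f a b hab
  have ha := orientedVolume_pos a.2.ne_zero hx.1
  have hb := orientedVolume_pos b.2.ne_zero hx.2
  have hΓ := eventually_codiscrete_coneRatio_ne_zero h ha hb h.isSection
  rw [Filter.eventually_and, Filter.eventually_and, Filter.eventually_and]
  refine ⟨?_, ?_, eventually_codiscrete_Delta_ne_zero f a μ ha,
    eventually_codiscrete_Delta_ne_zero f b μ hb⟩
  · simpa only [gammaFun_eq_coneRatio h] using hΓ 0 0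
  · simpa only [gammaFun_add_ev h] using hΓ (pair μ a) (pair μ b)

end Framing

end GammaWedge

end

/-- Off the zeros and poles of the products involved, which form a discrete closed set of `w` for
each `x`, the two sides agree. (A quotient of products is nonzero in Lean exactly when neither its
numerator nor its denominator vanishes, as `z / 0 = 0`.) -/
theorem mainTheorem11 (f : Framing) (a b : {a : Lattice3 // IsPrimitive a})
    (hab : LinearIndependent ℤ ![(a : Lattice3), (b : Lattice3)]) (μ : DualLattice3) :
    ∃ P : Polynomial RatField, P.degree ≤ 2 ∧ IsHomogeneousZero P ∧
      ∀ x ∈ domain a ∩ domain b,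
        (∀ i : ℕ, RegularAt (P.coeff i) x) ∧
        (∀ᶠ w in Filter.codiscrete ℂ, gammaFun a b w x ≠ 0 ∧ gammaFun a b (w + ev μ x) x ≠ 0 ∧
          Delta f a μ w x ≠ 0 ∧ Delta f b μ w x ≠ 0) ∧
        ∀ w : ℂ, gammaFun a b w x ≠ 0 → gammaFun a b (w + ev μ x) x ≠ 0 →
          Delta f a μ w x ≠ 0 → Delta f b μ w x ≠ 0 →
          gammaFun a b (w + ev μ x) x / gammaFun a b w x =
            Complex.exp (Real.pi * Complex.I * evalPoly P x w) *
              (Delta f a μ w x / Delta f b μ w x) := by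
  obtain ⟨φ, hφ, hquotient⟩ := exists_gammaFun_div_eq f hab μ
  obtain ⟨P, hdegree, hhomogeneous, hP⟩ := exists_polynomial_of_mem_exponents hφ
  refine ⟨P, hdegree, hhomogeneous, fun x hx => ⟨(hP x hx).1,
    eventually_codiscrete_gammaFun_Delta_ne_zero f hab μ hx, fun w hΓ _ ha hb => ?_⟩⟩
  rw [hquotient x hx w hΓ ha hb, (hP x hx).2 w]
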